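/- For $A\in\mathbb{R}^{m\times n}$ and $b\in\mathbb{R}^m$ let $\sigma(t)=\max(0,t)$ act coordinatewise, let $$\mathcal{L}_{A,b}=\inf_{x\neq y}\frac{1}{\sqrt m}\,\frac{\|\sigma(Ax+b)-\sigma(Ay+b)\|_2}{\|x-y\|_2},\qquad \mathcal{U}_{A,b}=\sup_{x\neq y}\frac{1}{\sqrt m}\,\frac{\|\sigma(Ax+b)-\sigma(Ay+b)\|_2}{\|x-y\|_2}$$ ($x,y$ ranging over $\mathbb{R}^n$), and let $\beta_{A,b}=\mathcal{U}_{A,b}/\mathcal{L}_{A,b}$, where $\beta_{A,b}=\infty$ if $\mathcal{L}_{A,b}=0$. A standard Gaussian matrix is a random matrix with independent $N(0,1)$ entries. For every $\delta$ with $0<\delta<4/5$ there are constants $c_\delta,C_\delta>0$, depending only on $\delta$, such that for all integers $n\geq 1$ and $m\geq C_\delta\, n$ and every standard Gaussian matrix $A\in\mathbb{R}^{m\times n}$, $$\mathbb{P}\big(\beta_{A,0}\leq\sqrt2+\delta\big)\;\geq\;1-2\exp(-c_\delta\, m).$$ Consequently the lower bound $\sqrt2$ for the condition number is asymptotically attained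 by Gaussian weights with zero bias: if $A_k$ are standard Gaussian matrices of sizes $m_k\times n_k$ with $n_k\geq1$ and $m_k/n_k\to\infty$ (for instance $n_k=n$ fixed and $m_k\to\infty$), then for every $\varepsilon>0$, $\mathbb{P}\big(\sqrt2\leq\beta_{A_k,0}\leq\sqrt2+\varepsilon\big)\to1$ as $k\to\infty$. -/

import Mathlib

open MeasureTheory ProbabilityTheory Filter Topology
open scoped ENNReal Matrix

noncomputable section

/-- The ReLU layer `x ↦ σ(A x + b)`, where `σ(t) = max 0 t` acts coordinatewise. -/
def reluLayer {m n : ℕ} (A : Matrix (Fin m) (Fin n) ℝ) (b : Fin m → ℝ)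
    (x : EuclideanSpace ℝ (Fin n)) : EuclideanSpace ℝ (Fin m) :=
  WithLp.toLp 2 fun i => max 0 ((A *ᵥ x.ofLp) i + b i)

/-- The normalized distance ratio `m^(-1/2) ‖σ(A x + b) - σ(A y + b)‖₂ / ‖x - y‖₂`. -/
def reluRatio {m n : ℕ} (A : Matrix (Fin m) (Fin n) ℝ) (b : Fin m → ℝ)
    (x y : EuclideanSpace ℝ (Fin n)) : ℝ :=
  1 / √(m : ℝ) * (‖reluLayer A b x - reluLayer A b y‖ / ‖x - y‖)

/-- The optimal lower Lipschitz constant: the infimum of the ratio over all `x ≠ y`. -/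
def lowerLip {m n : ℕ} (A : Matrix (Fin m) (Fin n) ℝ) (b : Fin m → ℝ) : ℝ≥0∞ :=
  ⨅ (x : EuclideanSpace ℝ (Fin n)) (y : EuclideanSpace ℝ (Fin n)) (_ : x ≠ y),
    ENNReal.ofReal (reluRatio A b x y)

/-- The optimal upper Lipschitz constant: the supremum of the ratio over all `x ≠ y`. -/
def upperLip {m n : ℕ} (A : Matrix (Fin m) (Fin n) ℝ) (b : Fin m → ℝ) : ℝ≥0∞ :=
  ⨆ (x : EuclideanSpace ℝ (Fin n)) (y : EuclideanSpace ℝ (Fin n)) (_ : x ≠ y),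
    ENNReal.ofReal (reluRatio A b x y)

open Classical in
/-- The condition number `β = U / L` of the layer, with values in `[0, ∞]`. It is `∞` whenever
the lower Lipschitz constant vanishes (also when the upper one vanishes as well), so a finite
bound on it always contains the assertion that the layer is bi-Lipschitz. -/
def conditionNumber {m n : ℕ} (A : Matrix (Fin m) (Fin n) ℝ) (b : Fin m → ℝ) : ℝ≥0∞ :=
  if lowerLip A b = 0 then ⊤ else upperLip A b / lowerLip A b

/-- `A` is a standard Gaussian random matrix on the probability space `(Ω, P)`: its entries are
independent and each of them has the law `N(0, 1)`. -/
structure IsStandardGaussianMatrix {Ω : Type*} [MeasurableSpace Ω] {m n : ℕ}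
    (A : Ω → Matrix (Fin m) (Fin n) ℝ) (P : Measure Ω) : Prop where
  hasLaw : ∀ i j, HasLaw (fun ω => A ω i j) (gaussianReal 0 1) P
  indep : iIndepFun (fun (p : Fin m × Fin n) ω => A ω p.1 p.2) P

end

/-! Let `g` be a Gaussian row, `p = ⟪g, x⟫`, `q = ⟪g, y⟫`. Adding the squared ReLU increment at `(p,
q)` to that at `(-p, -q)` gives between `(p - q)² / 2` and `(p - q)²` (`reluDiff_symm_bounds`).
Since `g` and `-g` have the same law, the mean squared increment lies between `‖x - y‖² / 4` and `‖x
- y‖² / 2`; the quotient 2 of these bounds becomes `√2` after a square root.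

It remains to pass from means to empirical averages, uniformly in `x, y` and with error relative to
`‖x - y‖²`. Bernstein's inequality, a net of the unit ball and an operator norm bound give a uniform
additive error for squares of Lipschitz functions of two linear functionals
(`overwhelming_quadAvg`); the net costs a factor `B ^ n`, absorbed once `m ≥ C n`. By homogeneity
`‖x‖ = 1` and `‖y‖ ≤ 1` suffice, and the additive error is enough for pairs at distance bounded
below.

For close pairs write `y = x - t z` with `‖z‖ = 1`. The increment is nearly `t 𝟙(p > 0) ⟪g, z⟫`,
which is not Lipschitz in the pair of functionals. It is replaced by the Lipschitz `gate`, and the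
loss is dominated by the Lipschitz `gateError` of small second moment. Both concentrate uniformly,
so the normalized average is near `1 / 2`.

Conversely, the points `x, -x, 0` force `β ≥ √2` for every matrix when `n ≥ 1`. -/

/-! ### Bernstein's inequality from exponential moments -/

theorem exp_le_one_add_add_sq_mul_exp_abs (y : ℝ) :
    Real.exp y ≤ 1 + y + y ^ 2 * Real.exp |y| := by
  have h := Complex.norm_exp_sub_sum_le_norm_mul_exp (y : ℂ) 2
  rw [Finset.sum_range_succ, Finset.sum_range_one] at h
  norm_num at h
  rw [← Complex.ofReal_one, ← Complex.ofReal_add, ← Complex.ofReal_exp, ← Complex.ofReal_sub,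
    Complex.norm_real, Real.norm_eq_abs] at h
  linarith [le_abs_self (Real.exp y - (1 + y))]

/-- Half of the exponent `s |x|` absorbs `exp |l x|`; the other half absorbs `x²` through `u² / 2 ≤
exp u`. -/
theorem sq_mul_exp_le {s l x : ℝ} (hs : 0 < s) (hl : |l| ≤ s / 2) :
    (l * x) ^ 2 * Real.exp |l * x| ≤ l ^ 2 * (8 / s ^ 2) * Real.exp (s * |x|) := by
  have h1 : (s / 2 * |x|) ^ 2 / 2 ≤ Real.exp (s / 2 * |x|) := by
    have := Real.quadratic_le_exp_of_nonneg (x := s / 2 * |x|) (by positivity)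
    have h0 : 0 ≤ s / 2 * |x| := by positivity
    linarith
  have h2 : Real.exp |l * x| ≤ Real.exp (s / 2 * |x|) := by
    rw [abs_mul]; gcongr
  have h3 : x ^ 2 ≤ 8 / s ^ 2 * Real.exp (s / 2 * |x|) := by
    rw [div_mul_eq_mul_div, le_div_iff₀ (by positivity)]
    rw [mul_pow, sq_abs] at h1
    linarith
  calc (l * x) ^ 2 * Real.exp |l * x|
      ≤ (l ^ 2 * (8 / s ^ 2 * Real.exp (s / 2 * |x|))) * Real.exp (s / 2 * |x|) := by
        rw [mul_pow]; gcongr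
    _ = l ^ 2 * (8 / s ^ 2) * (Real.exp (s / 2 * |x|) * Real.exp (s / 2 * |x|)) := by ring
    _ = _ := by rw [← Real.exp_add]; ring_nf

section
variable {Ω : Type*} [MeasurableSpace Ω] {P : Measure Ω}

theorem integrable_of_integrable_exp_abs {X : Ω → ℝ} {s : ℝ} (hs : 0 < s) (hX : Measurable X)
    (hint : Integrable (fun ω => Real.exp (s * |X ω|)) P) : Integrable X P := by
  refine (hint.const_mul (1 / s)).mono' hX.aestronglyMeasurable (ae_of_all _ fun ω => ?_)
  rw [Real.norm_eq_abs, one_div, inv_mul_eq_div, le_div_iff₀ hs]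
  linarith [Real.add_one_le_exp (s * |X ω|)]

theorem integrable_exp_mul_of_abs_le {X : Ω → ℝ} {s l : ℝ} (hX : Measurable X)
    (hint : Integrable (fun ω => Real.exp (s * |X ω|)) P) (hl : |l| ≤ s) :
    Integrable (fun ω => Real.exp (l * X ω)) P := by
  refine hint.mono' (by fun_prop) (ae_of_all _ fun ω => ?_)
  rw [Real.norm_eq_abs, Real.abs_exp]
  refine Real.exp_le_exp.2 ?_
  calc l * X ω ≤ |l * X ω| := le_abs_self _
    _ = |l| * |X ω| := abs_mul _ _
    _ ≤ _ := by gcongr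

variable [IsProbabilityMeasure P]

theorem mgf_le_of_integral_exp_abs_le {X : Ω → ℝ} {s D l : ℝ} (hs : 0 < s) (hX : Measurable X)
    (hint : Integrable (fun ω => Real.exp (s * |X ω|)) P)
    (hD : ∫ ω, Real.exp (s * |X ω|) ∂P ≤ D) (hl : |l| ≤ s / 2) :
    mgf X P l ≤ Real.exp (l * ∫ ω, X ω ∂P + l ^ 2 * (8 / s ^ 2 * D)) := by
  have hXi := integrable_of_integrable_exp_abs hs hX hint
  have hrhs : Integrable (fun ω => 1 + l * X ω + l ^ 2 * (8 / s ^ 2) * Real.exp (s * |X ω|)) P :=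
    ((integrable_const _).add (hXi.const_mul l)).add (hint.const_mul _)
  calc mgf X P l
      ≤ ∫ ω, 1 + l * X ω + l ^ 2 * (8 / s ^ 2) * Real.exp (s * |X ω|) ∂P := by
        refine integral_mono (integrable_exp_mul_of_abs_le hX hint (by linarith)) hrhs
          fun ω => ?_
        exact (exp_le_one_add_add_sq_mul_exp_abs _).trans (add_le_add le_rfl (sq_mul_exp_le hs hl))
    _ = 1 + l * ∫ ω, X ω ∂P + l ^ 2 * (8 / s ^ 2) * ∫ ω, Real.exp (s * |X ω|) ∂P := by
        have h1 := integral_add ((integrable_const (μ := P) (1 : ℝ)).add (hXi.const_mul l))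
          (hint.const_mul (l ^ 2 * (8 / s ^ 2)))
        have h2 := integral_add (integrable_const (μ := P) (1 : ℝ)) (hXi.const_mul l)
        simp only [Pi.add_apply] at h1
        rw [h1, h2, integral_const_mul, integral_const_mul]
        simp
    _ ≤ 1 + (l * ∫ ω, X ω ∂P + l ^ 2 * (8 / s ^ 2 * D)) := by
        rw [add_assoc, ← mul_assoc]; gcongr
    _ ≤ _ := by linarith [Real.add_one_le_exp (l * ∫ ω, X ω ∂P + l ^ 2 * (8 / s ^ 2 * D))]

/-- Chernoff's bound: `hlη` makes the quadratic term of the log-mgf cost at most half of the gain `l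
η`. -/
theorem measureReal_le_sum_sub_integral_le {m : ℕ} {X : Fin m → Ω → ℝ} {s D η l : ℝ} (hs : 0 < s)
    (hind : iIndepFun X P) (hX : ∀ i, Measurable (X i))
    (hint : ∀ i, Integrable (fun ω => Real.exp (s * |X i ω|)) P)
    (hD : ∀ i, ∫ ω, Real.exp (s * |X i ω|) ∂P ≤ D) (hl0 : 0 ≤ l) (hl : l ≤ s / 2)
    (hlη : l * (8 / s ^ 2 * D) ≤ η / 2) :
    P.real {ω | η * m ≤ ∑ i, (X i ω - ∫ ω', X i ω' ∂P)} ≤ Real.exp (-(l * η / 2) * m) := by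
  have hl' : |l| ≤ s / 2 := by rwa [abs_of_nonneg hl0]
  set S := ∑ i, ∫ ω', X i ω' ∂P with hS
  have hset : {ω | η * m ≤ ∑ i, (X i ω - ∫ ω', X i ω' ∂P)} =
      {ω | S + η * m ≤ (∑ i, X i) ω} := by
    ext ω
    simp only [Set.mem_ofPred_eq, Finset.sum_sub_distrib, Finset.sum_apply, ← hS]
    constructor <;> intro h <;> linarith
  rw [hset]
  refine (measure_ge_le_exp_mul_mgf _ hl0 (hind.integrable_exp_mul_sum hX fun i _ =>
    integrable_exp_mul_of_abs_le (hX i) (hint i) (by linarith))).trans ?_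
  rw [hind.mgf_sum hX]
  calc Real.exp (-l * (S + η * m)) * ∏ i, mgf (X i) P l
      ≤ Real.exp (-l * (S + η * m)) *
          ∏ i, Real.exp (l * ∫ ω, X i ω ∂P + l ^ 2 * (8 / s ^ 2 * D)) := by
        gcongr with i
        · exact fun i _ => mgf_nonneg
        · exact mgf_le_of_integral_exp_abs_le hs (hX i) (hint i) (hD i) hl'
    _ = Real.exp (-l * (η * m) + m * (l * (l * (8 / s ^ 2 * D)))) := by
        rw [← Real.exp_sum, ← Real.exp_add, Finset.sum_add_distrib, ← Finset.mul_sum, ← hS]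
        congr 1
        simp
        ring
    _ ≤ Real.exp (-l * (η * m) + m * (l * (η / 2))) := by gcongr
    _ = _ := by ring_nf
end

/-- A Bernstein-type inequality for independent variables with uniformly bounded exponential
moments, with a rate that depends only on the moment bound and on the deviation. -/
theorem exists_rate_abs_sum_sub_integral {s D η : ℝ} (hs : 0 < s) (hD0 : 0 ≤ D) (hη : 0 < η) :
    ∃ c : ℝ, 0 < c ∧ ∀ (Ω : Type) [MeasurableSpace Ω] (P : Measure Ω) [IsProbabilityMeasure P]
      (m : ℕ) (X : Fin m → Ω → ℝ), iIndepFun X P → (∀ i, Measurable (X i)) →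
      (∀ i, Integrable (fun ω => Real.exp (s * |X i ω|)) P) →
      (∀ i, ∫ ω, Real.exp (s * |X i ω|) ∂P ≤ D) →
      P.real {ω | ¬ |∑ i, (X i ω - ∫ ω', X i ω' ∂P)| ≤ η * m} ≤ 2 * Real.exp (-c * m) := by
  set M := 8 / s ^ 2 * D with hM
  have hM0 : 0 ≤ M := by positivity
  -- The first entry keeps the mgf bound valid, the second gives `l M ≤ η / 2`; the `+ 1` covers `M
  -- = 0`.
  set l := min (s / 2) (η / (2 * (M + 1))) with hl
  have hlpos : 0 < l := by positivity
  have hl1 : l ≤ s / 2 := min_le_left _ _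
  have hl2 : l * M ≤ η / 2 := by
    have : l ≤ η / (2 * (M + 1)) := min_le_right _ _
    rw [le_div_iff₀ (by positivity)] at this
    nlinarith
  refine ⟨l * η / 2, by positivity, fun Ω _ P _ m X hind hX hint hD => ?_⟩
  have h1 := measureReal_le_sum_sub_integral_le hs hind hX hint hD hlpos.le hl1 hl2
  have h2 := measureReal_le_sum_sub_integral_le (X := fun i ω => -X i ω) hs
    (hind.comp (fun _ x => -x) fun _ => measurable_neg) (fun i => (hX i).neg)
    (by simpa using hint) (by simpa using hD) hlpos.le hl1 hl2
  have hsub : {ω | ¬ |∑ i, (X i ω - ∫ ω', X i ω' ∂P)| ≤ η * m} ⊆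
      {ω | η * m ≤ ∑ i, (X i ω - ∫ ω', X i ω' ∂P)} ∪
      {ω | η * m ≤ ∑ i, (-X i ω - ∫ ω', -X i ω' ∂P)} := by
    intro ω hω
    have hneg : ∑ i, (-X i ω - ∫ ω', -X i ω' ∂P) = -∑ i, (X i ω - ∫ ω', X i ω' ∂P) := by
      rw [← Finset.sum_neg_distrib]
      refine Finset.sum_congr rfl fun i _ => ?_
      rw [integral_neg]; ring
    simp only [Set.mem_ofPred_eq, Set.mem_union, hneg] at hω ⊢
    rw [not_le, lt_abs] at hω
    exact hω.imp le_of_lt le_of_lt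
  calc _ ≤ _ := measureReal_mono hsub
    _ ≤ _ := measureReal_union_le _ _
    _ ≤ Real.exp (-(l * η / 2) * m) + Real.exp (-(l * η / 2) * m) := add_le_add h1 h2
    _ = _ := by ring

/-! ### Nets of the unit ball -/

section
variable {E : Type*} [NormedAddCommGroup E] [NormedSpace ℝ E] [FiniteDimensional ℝ E]

/-- Volume comparison: the balls of radius `ε / 2` about the points are disjoint and lie in the ball
of radius `1 + ε / 2`. -/
theorem card_le_of_separated_of_norm_le_one {ε : ℝ} (hε : 0 < ε) (s : Finset E)
    (hs : ∀ c ∈ s, ‖c‖ ≤ 1) (h : ∀ c ∈ s, ∀ d ∈ s, c ≠ d → ε ≤ ‖c - d‖) :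
    (s.card : ℝ) ≤ (1 + 2 / ε) ^ Module.finrank ℝ E := by
  borelize E
  let μ : Measure E := Measure.addHaar
  have δpos : 0 < ε / 2 := by positivity
  have ρpos : 0 < 1 + ε / 2 := by positivity
  have D : Set.Pairwise (s : Set E) (Function.onFun Disjoint fun c => Metric.ball c (ε / 2)) := by
    rintro c hc d hd hcd
    apply Metric.ball_disjoint_ball
    rw [dist_eq_norm]
    linarith [h c hc d hd hcd]
  have hsub : (⋃ c ∈ s, Metric.ball c (ε / 2)) ⊆ Metric.ball (0 : E) (1 + ε / 2) := by
    refine Set.iUnion₂_subset fun x hx => Metric.ball_subset_ball' ?_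
    rw [dist_zero_right]
    linarith [hs x hx]
  have I : (s.card : ℝ≥0∞) * ENNReal.ofReal ((ε / 2) ^ Module.finrank ℝ E) *
      μ (Metric.ball 0 1) ≤
      ENNReal.ofReal ((1 + ε / 2) ^ Module.finrank ℝ E) * μ (Metric.ball 0 1) :=
    calc _ = μ (⋃ c ∈ s, Metric.ball c (ε / 2)) := by
          rw [measure_biUnion_finset D fun c _ => measurableSet_ball]
          simp only [μ.addHaar_ball_of_pos _ δpos]
          simp only [Finset.sum_const, nsmul_eq_mul, mul_assoc]
      _ ≤ μ (Metric.ball (0 : E) (1 + ε / 2)) := measure_mono hsub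
      _ = _ := by simp only [μ.addHaar_ball_of_pos _ ρpos]
  have J := (ENNReal.mul_le_mul_iff_left (Metric.measure_ball_pos _ _ zero_lt_one).ne'
    measure_ball_lt_top.ne).1 I
  have K := ENNReal.toReal_le_of_le_ofReal (pow_nonneg ρpos.le _) J
  rw [ENNReal.toReal_mul, ENNReal.toReal_natCast, ENNReal.toReal_ofReal (by positivity),
    ← le_div_iff₀ (by positivity), ← div_pow] at K
  have hε' : (1 + ε / 2) / (ε / 2) = 1 + 2 / ε := by field_simp; ring
  rwa [hε'] at K

theorem exists_finset_net_unitBall (E : Type*) [NormedAddCommGroup E] [NormedSpace ℝ E]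
    [FiniteDimensional ℝ E] {ε : ℝ} (hε : 0 < ε) :
    ∃ N : Finset E, (∀ x ∈ N, ‖x‖ ≤ 1) ∧ (N.card : ℝ) ≤ (1 + 2 / ε) ^ Module.finrank ℝ E ∧
      ∀ x : E, ‖x‖ ≤ 1 → ∃ y ∈ N, ‖x - y‖ ≤ ε := by
  classical
  let p : ℕ → Prop := fun k => ∃ s : Finset E, s.card = k ∧ (∀ c ∈ s, ‖c‖ ≤ 1) ∧
    ∀ c ∈ s, ∀ d ∈ s, c ≠ d → ε ≤ ‖c - d‖
  have hb : ∀ k, p k → k ≤ ⌊(1 + 2 / ε) ^ Module.finrank ℝ E⌋₊ := by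
    rintro k ⟨s, rfl, h1, h2⟩
    exact Nat.le_floor (card_le_of_separated_of_norm_le_one hε s h1 h2)
  have h0 : p 0 := ⟨∅, by simp⟩
  -- A separated set of maximal cardinality is a net: a point far from all of it could be added.
  obtain ⟨s, hs, h1, h2⟩ := Nat.findGreatest_spec (P := p) (Nat.zero_le
    ⌊(1 + 2 / ε) ^ Module.finrank ℝ E⌋₊) h0
  refine ⟨s, h1, card_le_of_separated_of_norm_le_one hε s h1 h2, fun x hx => ?_⟩
  by_contra! hcon
  have hxs : x ∉ s := fun hmem => by
    have := hcon x hmem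
    simp at this
    linarith
  have hp : p (s.card + 1) := by
    refine ⟨insert x s, Finset.card_insert_of_notMem hxs, ?_, ?_⟩
    · simpa [hx] using h1
    · intro c hc d hd hcd
      rw [Finset.mem_insert] at hc hd
      rcases hc with rfl | hc <;> rcases hd with rfl | hd
      · exact absurd rfl hcd
      · exact (hcon d hd).le
      · rw [norm_sub_rev]; exact (hcon c hc).le
      · exact h2 c hc d hd hcd
  have := Nat.le_findGreatest (P := p) (hb _ hp) hp
  omega
end

/-! ### Events of overwhelming probability -/

/-- The law of the rows of a standard Gaussian matrix of size `m × n`. -/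
noncomputable def gaussianRows (m n : ℕ) : Measure (Fin m → EuclideanSpace ℝ (Fin n)) :=
  Measure.pi fun _ => stdGaussian (EuclideanSpace ℝ (Fin n))

instance (m n : ℕ) : IsProbabilityMeasure (gaussianRows m n) := by
  unfold gaussianRows; infer_instance

/-- The property `Q` of the rows of an `m × n` Gaussian matrix fails with probability at most
`2 exp (-c m)`, uniformly over all `m ≥ C n`. -/
def Overwhelming (Q : ∀ m n : ℕ, (Fin m → EuclideanSpace ℝ (Fin n)) → Prop) : Prop :=
  ∃ c : ℝ, 0 < c ∧ ∃ C : ℝ, 0 < C ∧ ∀ m n : ℕ, 0 < n → C * (n : ℝ) ≤ (m : ℝ) →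
    (gaussianRows m n).real {a | ¬ Q m n a} ≤ 2 * Real.exp (-c * (m : ℝ))

namespace Overwhelming

variable {Q Q' : ∀ m n : ℕ, (Fin m → EuclideanSpace ℝ (Fin n)) → Prop}

theorem mono (h : Overwhelming Q) (hQ : ∀ m n a, 0 < n → 0 < m → Q m n a → Q' m n a) :
    Overwhelming Q' := by
  obtain ⟨c, hc, C, hC, h⟩ := h
  refine ⟨c, hc, C, hC, fun m n hn hm => le_trans (measureReal_mono ?_) (h m n hn hm)⟩
  have hm0 : 0 < m := by
    have : (0 : ℝ) < m := lt_of_lt_of_le (by positivity) hm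
    exact_mod_cast this
  exact fun a ha hQa => ha (hQ m n a hn hm0 hQa)

/-- A bound with prefactor `B ^ n` on the failure probability is enough. -/
theorem of_le {c C B : ℝ} (hc : 0 < c) (hB : 1 ≤ B) (hC : 0 < C)
    (h : ∀ m n : ℕ, 0 < n → C * (n : ℝ) ≤ (m : ℝ) →
      (gaussianRows m n).real {a | ¬ Q m n a} ≤ 2 * B ^ n * Real.exp (-c * (m : ℝ))) :
    Overwhelming Q := by
  -- For `m ≥ (2 log B / c) n` half of the rate pays for the prefactor: `B ^ n ≤ exp (c m / 2)`.
  refine ⟨c / 2, by positivity, max C (2 * Real.log B / c), lt_max_of_lt_left hC,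
    fun m n hn hm => ?_⟩
  have hn' : (0 : ℝ) ≤ n := Nat.cast_nonneg n
  have h1 : C * n ≤ m := le_trans (by gcongr; exact le_max_left _ _) hm
  have h2 : 2 * Real.log B / c * n ≤ m := le_trans (by gcongr; exact le_max_right _ _) hm
  refine (h m n hn h1).trans ?_
  have h3 : B ^ n = Real.exp (Real.log B * n) := by
    rw [mul_comm, ← Real.log_pow, Real.exp_log (by positivity)]
  rw [h3, mul_assoc, ← Real.exp_add]
  gcongr
  rw [div_mul_eq_mul_div, div_le_iff₀ hc] at h2
  linarith

theorem and (h : Overwhelming Q) (h' : Overwhelming Q') :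
    Overwhelming fun m n a => Q m n a ∧ Q' m n a := by
  obtain ⟨c, hc, C, hC, h⟩ := h
  obtain ⟨c', hc', C', hC', h'⟩ := h'
  -- The sum of two failure bounds has prefactor `4 ≤ 2 * 2 ^ n`, as `n ≥ 1`; hence `B = 2`.
  refine of_le (c := min c c') (C := max C C') (B := 2) (by positivity) (by norm_num)
    (lt_max_of_lt_left hC) fun m n hn hm => ?_
  have hn' : (0 : ℝ) ≤ n := Nat.cast_nonneg n
  have h1 := h m n hn (le_trans (by gcongr; exact le_max_left _ _) hm)
  have h2 := h' m n hn (le_trans (by gcongr; exact le_max_right _ _) hm)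
  have hsub : {a | ¬ (Q m n a ∧ Q' m n a)} ⊆ {a | ¬ Q m n a} ∪ {a | ¬ Q' m n a} := by
    intro a ha
    simpa only [Set.mem_ofPred_eq, Set.mem_union, not_and_or] using ha
  have h3 : Real.exp (-c * m) ≤ Real.exp (-min c c' * m) := by
    gcongr; exact min_le_left _ _
  have h4 : Real.exp (-c' * m) ≤ Real.exp (-min c c' * m) := by
    gcongr; exact min_le_right _ _
  have h5 : (2 : ℝ) ≤ 2 ^ n := by
    calc (2 : ℝ) = 2 ^ 1 := by norm_num
      _ ≤ 2 ^ n := pow_le_pow_right₀ (by norm_num) hn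
  calc _ ≤ _ := measureReal_mono hsub
    _ ≤ _ := measureReal_union_le _ _
    _ ≤ 2 * Real.exp (-c * m) + 2 * Real.exp (-c' * m) := add_le_add h1 h2
    _ ≤ 2 * 2 * Real.exp (-min c c' * m) := by linarith
    _ ≤ _ := by gcongr

/-- A union bound over families of at most `L ^ n` properties. -/
theorem forall_mem {ι : ℕ → Type*} {c L : ℝ} (hc : 0 < c) (hL : 1 ≤ L) (N : ∀ n, Finset (ι n))
    (hN : ∀ n, ((N n).card : ℝ) ≤ L ^ n)
    {R : ∀ m n : ℕ, ι n → (Fin m → EuclideanSpace ℝ (Fin n)) → Prop}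
    (h : ∀ m n, 0 < m → ∀ t ∈ N n,
      (gaussianRows m n).real {a | ¬ R m n t a} ≤ 2 * Real.exp (-c * m)) :
    Overwhelming fun m n a => ∀ t ∈ N n, R m n t a := by
  refine of_le (C := 1) hc hL one_pos fun m n hn hm => ?_
  have hm0 : 0 < m := by
    have : (0 : ℝ) < m := lt_of_lt_of_le (by positivity) hm
    exact_mod_cast this
  have hset : {a | ¬ ∀ t ∈ N n, R m n t a} = ⋃ t ∈ N n, {a | ¬ R m n t a} := by
    ext a
    simp only [Set.mem_ofPred_eq, Set.mem_iUnion, not_forall, exists_prop]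
  rw [hset]
  calc _ ≤ _ := measureReal_biUnion_finset_le _ _
    _ ≤ ∑ t ∈ N n, 2 * Real.exp (-c * m) := Finset.sum_le_sum (h m n hm0)
    _ = (N n).card * (2 * Real.exp (-c * m)) := by rw [Finset.sum_const, nsmul_eq_mul]
    _ ≤ L ^ n * (2 * Real.exp (-c * m)) := by gcongr; exact hN n
    _ = _ := by ring

/-- Transfer to an arbitrary realization of the Gaussian matrix. -/
theorem exists_isStandardGaussianMatrix (h : Overwhelming Q) :
    ∃ c : ℝ, 0 < c ∧ ∃ C : ℝ, 0 < C ∧ ∀ m n : ℕ, 0 < n → C * (n : ℝ) ≤ (m : ℝ) →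
      ∀ (Ω : Type*) [MeasurableSpace Ω] (P : Measure Ω) [IsProbabilityMeasure P]
        (A : Ω → Matrix (Fin m) (Fin n) ℝ), IsStandardGaussianMatrix A P →
        1 - 2 * Real.exp (-c * (m : ℝ)) ≤
          P.real {ω | Q m n fun i => WithLp.toLp 2 (A ω i)} := by
  obtain ⟨c, hc, C, hC, h⟩ := h
  refine ⟨c, hc, C, hC, fun m n hn hm Ω _ P _ A hA => ?_⟩
  have hmeas : AEMeasurable (fun ω (p : Fin m × Fin n) => A ω p.1 p.2) P :=
    aemeasurable_pi_iff.2 fun p => (hA.hasLaw p.1 p.2).aemeasurable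
  have hlaw1 : P.map (fun ω (p : Fin m × Fin n) => A ω p.1 p.2) =
      Measure.infinitePi fun _ => gaussianReal 0 1 := by
    rw [(iIndepFun_iff_map_fun_eq_infinitePi_map₀ hmeas).1 hA.indep]
    congr with p : 1
    exact (hA.hasLaw p.1 p.2).map_eq
  let F : (Fin m × Fin n → ℝ) → (Fin m → EuclideanSpace ℝ (Fin n)) :=
    fun v i => WithLp.toLp 2 (MeasurableEquiv.curry (Fin m) (Fin n) ℝ v i)
  have hF : Measurable F := by fun_prop
  have hlaw : P.map (fun ω i => WithLp.toLp 2 (A ω i)) = gaussianRows m n := by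
    have : (fun ω i => WithLp.toLp 2 (A ω i)) = F ∘ fun ω (p : Fin m × Fin n) => A ω p.1 p.2 := by
      ext; simp [F]
    rw [this, ← AEMeasurable.map_map_of_aemeasurable hF.aemeasurable hmeas, hlaw1]
    have hF2 : F = (fun w i => WithLp.toLp 2 (w i)) ∘ MeasurableEquiv.curry (Fin m) (Fin n) ℝ := rfl
    rw [hF2, ← Measure.map_map (by fun_prop) (by fun_prop),
      Measure.infinitePi_map_curry (fun _ _ => gaussianReal 0 1), Measure.infinitePi_eq_pi]
    simp_rw [Measure.infinitePi_eq_pi]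
    rw [Measure.pi_map_pi (fun i => by fun_prop)]
    simp_rw [map_pi_eq_stdGaussian]
    rfl
  have hAm : AEMeasurable (fun ω i => WithLp.toLp 2 (A ω i)) P := by
    have := hF.comp_aemeasurable hmeas
    exact this
  have h1 : P.real {ω | ¬ Q m n fun i => WithLp.toLp 2 (A ω i)} ≤ 2 * Real.exp (-c * m) := by
    refine le_trans ?_ (h m n hn hm)
    rw [← hlaw]
    have : IsProbabilityMeasure (P.map (fun ω i => WithLp.toLp 2 (A ω i))) :=
      Measure.isProbabilityMeasure_map hAm
    -- `Q` need not be measurable: this inequality for image measures holds for every set, and below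
    -- only subadditivity is used for the complement.
    exact ENNReal.toReal_mono (measure_ne_top _ _) (Measure.le_map_apply hAm _)
  have h2 : (1 : ℝ) ≤ P.real {ω | Q m n fun i => WithLp.toLp 2 (A ω i)} +
      P.real {ω | ¬ Q m n fun i => WithLp.toLp 2 (A ω i)} := by
    refine le_trans ?_ (measureReal_union_le _ _)
    rw [← probReal_univ (μ := P)]
    exact measureReal_mono fun ω _ => em _
  linarith

end Overwhelming

/-! ### Gaussian marginals and quadratic means -/

theorem integrable_exp_sq_div_four_gaussianReal :
    Integrable (fun t : ℝ => Real.exp (t ^ 2 / 4)) (gaussianReal 0 1) := by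
  rw [gaussianReal_of_var_ne_zero 0 one_ne_zero,
    integrable_withDensity_iff (measurable_gaussianPDF 0 1)
      (ae_of_all _ fun _ => gaussianPDF_lt_top)]
  have h := (integrable_exp_neg_mul_sq (b := 1 / 4) (by norm_num)).const_mul
    ((√(2 * Real.pi))⁻¹)
  refine h.congr (ae_of_all _ fun t => ?_)
  simp only [toReal_gaussianPDF, gaussianPDFReal, NNReal.coe_one, mul_one, sub_zero]
  rw [mul_left_comm, ← Real.exp_add]
  ring_nf

theorem integrable_pow_gaussianReal (k : ℕ) :
    Integrable (fun t : ℝ => t ^ k) (gaussianReal 0 1) := by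
  have h := (memLp_id_gaussianReal (μ := 0) (v := 1) k).integrable_norm_pow'
  exact h.mono' (by fun_prop) (ae_of_all _ fun t => by simp)

theorem integral_sq_gaussianReal : ∫ t : ℝ, t ^ 2 ∂gaussianReal 0 1 = 1 := by
  have h := variance_fun_id_gaussianReal (μ := 0) (v := 1)
  rw [variance_eq_sub (X := fun t : ℝ => t) (memLp_id_gaussianReal 2)] at h
  have h0 : ∫ t : ℝ, t ∂gaussianReal 0 1 = 0 := integral_id_gaussianReal
  simpa [h0] using h

section
variable {E : Type*} [NormedAddCommGroup E] [InnerProductSpace ℝ E] [FiniteDimensional ℝ E]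
  [MeasurableSpace E] [BorelSpace E]

theorem stdGaussian_map_inner (x : E) :
    (stdGaussian E).map (fun g => inner ℝ g x) = (gaussianReal 0 1).map (fun t => ‖x‖ * t) := by
  have h := IsGaussian.map_eq_gaussianReal (μ := stdGaussian E) (innerSL ℝ x)
  rw [integral_strongDual_stdGaussian, variance_dual_stdGaussian, innerSL_apply_norm] at h
  rw [gaussianReal_map_const_mul]
  convert h using 2
  · ext g; simp [real_inner_comm]
  · simp
  · ext; simp

theorem integral_inner_stdGaussian (x : E) {φ : ℝ → ℝ} (hφ : Measurable φ) :
    ∫ g, φ (inner ℝ g x) ∂stdGaussian E = ∫ t, φ (‖x‖ * t) ∂gaussianReal 0 1 := by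
  rw [← integral_map (φ := fun g => inner ℝ g x) (f := φ) (by fun_prop)
    hφ.aestronglyMeasurable, stdGaussian_map_inner,
    integral_map (by fun_prop) hφ.aestronglyMeasurable]

theorem integrable_inner_stdGaussian_iff (x : E) {φ : ℝ → ℝ} (hφ : Measurable φ) :
    Integrable (fun g => φ (inner ℝ g x)) (stdGaussian E) ↔
      Integrable (fun t => φ (‖x‖ * t)) (gaussianReal 0 1) := by
  have h1 := integrable_map_measure (μ := stdGaussian E) (f := fun g : E => inner ℝ g x) (g := φ)
    hφ.aestronglyMeasurable (by fun_prop)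
  have h2 := integrable_map_measure (μ := gaussianReal 0 1) (f := fun t => ‖x‖ * t) (g := φ)
    hφ.aestronglyMeasurable (by fun_prop)
  rw [stdGaussian_map_inner] at h1
  exact h1.symm.trans h2

theorem integrable_inner_pow_stdGaussian (x : E) (k : ℕ) :
    Integrable (fun g => (inner ℝ g x) ^ k) (stdGaussian E) := by
  rw [integrable_inner_stdGaussian_iff x (φ := fun t => t ^ k) (by fun_prop)]
  simp_rw [mul_pow]
  exact (integrable_pow_gaussianReal k).const_mul _

theorem integral_inner_sq_stdGaussian (x : E) :
    ∫ g, (inner ℝ g x) ^ 2 ∂stdGaussian E = ‖x‖ ^ 2 := by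
  rw [integral_inner_stdGaussian x (φ := fun t => t ^ 2) (by fun_prop)]
  simp_rw [mul_pow]
  rw [integral_const_mul, integral_sq_gaussianReal, mul_one]

theorem exp_mul_sq_div_four_le {r : ℝ} (hr0 : 0 ≤ r) (hr : r ≤ 1) (t : ℝ) :
    Real.exp ((r * t) ^ 2 / 4) ≤ Real.exp (t ^ 2 / 4) := by
  have : r ^ 2 ≤ 1 := pow_le_one₀ hr0 hr
  rw [mul_pow]
  gcongr
  exact mul_le_of_le_one_left (sq_nonneg _) this

theorem integrable_exp_inner_sq {x : E} (hx : ‖x‖ ≤ 1) :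
    Integrable (fun g => Real.exp ((inner ℝ g x) ^ 2 / 4)) (stdGaussian E) := by
  rw [integrable_inner_stdGaussian_iff x (φ := fun t => Real.exp (t ^ 2 / 4)) (by fun_prop)]
  refine integrable_exp_sq_div_four_gaussianReal.mono' (by fun_prop) (ae_of_all _ fun t => ?_)
  rw [Real.norm_eq_abs, Real.abs_exp]
  exact exp_mul_sq_div_four_le (norm_nonneg _) hx t

/-- The bound involves neither `x` nor the dimension, which makes the Bernstein rate uniform in
both. -/
theorem integral_exp_inner_sq_le {x : E} (hx : ‖x‖ ≤ 1) :
    ∫ g, Real.exp ((inner ℝ g x) ^ 2 / 4) ∂stdGaussian E ≤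
      ∫ t, Real.exp (t ^ 2 / 4) ∂gaussianReal 0 1 := by
  have h := integrable_exp_inner_sq hx
  rw [integrable_inner_stdGaussian_iff x (φ := fun t => Real.exp (t ^ 2 / 4)) (by fun_prop)] at h
  rw [integral_inner_stdGaussian x (φ := fun t => Real.exp (t ^ 2 / 4)) (by fun_prop)]
  exact integral_mono h integrable_exp_sq_div_four_gaussianReal (exp_mul_sq_div_four_le (norm_nonneg _) hx)

theorem integral_stdGaussian_comp_neg (F : E → ℝ) :
    ∫ g, F (-g) ∂stdGaussian E = ∫ g, F g ∂stdGaussian E := by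
  have h := stdGaussian_map (LinearIsometryEquiv.neg ℝ : E ≃ₗᵢ[ℝ] E)
  conv_rhs => rw [← h]
  exact ((LinearIsometryEquiv.neg ℝ : E ≃ₗᵢ[ℝ] E).toHomeomorph.measurableEmbedding.integral_map
    F).symm

/-- The second moment of `f (⟪g, x⟫) (⟪g, z⟫)` for a standard Gaussian vector `g`. -/
noncomputable def quadMean (f : ℝ → ℝ → ℝ) (x z : E) : ℝ :=
  ∫ g, f (inner ℝ g x) (inner ℝ g z) ^ 2 ∂stdGaussian E

/-- The empirical counterpart of `quadMean` over the sample `a`. -/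
noncomputable def quadAvg {m : ℕ} (f : ℝ → ℝ → ℝ) (a : Fin m → E) (x z : E) : ℝ :=
  (∑ i, f (inner ℝ (a i) x) (inner ℝ (a i) z) ^ 2) / m

theorem integrable_sq_of_growth {f : ℝ → ℝ → ℝ} {α : ℝ} (hf : Measurable (Function.uncurry f))
    (hα : ∀ p q, f p q ^ 2 ≤ α * (1 + p ^ 2 + q ^ 2)) (x z : E) :
    Integrable (fun g => f (inner ℝ g x) (inner ℝ g z) ^ 2) (stdGaussian E) := by
  have hm : Measurable fun g : E => f (inner ℝ g x) (inner ℝ g z) := by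
    exact hf.comp (f := fun g : E => ((inner ℝ g x : ℝ), (inner ℝ g z : ℝ))) (by fun_prop)
  refine ((((integrable_const (1 : ℝ)).add (integrable_inner_pow_stdGaussian x 2)).add
    (integrable_inner_pow_stdGaussian z 2)).const_mul α).mono' (hm.pow_const 2).aestronglyMeasurable
    (ae_of_all _ fun g => ?_)
  rw [Real.norm_eq_abs, abs_of_nonneg (sq_nonneg _)]
  exact hα _ _
end

/-! ### Concentration at a fixed pair -/

/-- The scale bounds the exponent by `(1 + p² + q²) / 8`; then `exp (1 / 8) ≤ 2` and `2ab ≤ a² + b²`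
separate `p` from `q`. -/
theorem exp_growth_le {α u p q : ℝ} (hα : 0 ≤ α) (hu : u ≤ α * (1 + p ^ 2 + q ^ 2)) :
    Real.exp (1 / (8 * (α + 1)) * u) ≤
      Real.exp (p ^ 2 / 4) + Real.exp (q ^ 2 / 4) := by
  have h1 : 1 / (8 * (α + 1)) * u ≤ 1 / 8 + p ^ 2 / 8 + q ^ 2 / 8 := by
    rw [one_div_mul_eq_div, div_le_iff₀ (by positivity)]
    nlinarith [sq_nonneg p, sq_nonneg q]
  have h2 : Real.exp (1 / 8) ≤ 2 := by
    have := Real.exp_one_lt_d9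
    have h3 : Real.exp (1 / 8) ^ 8 = Real.exp 1 := by
      rw [← Real.exp_nat_mul]; norm_num
    by_contra! hcon
    have : (2 : ℝ) ^ 8 < Real.exp (1 / 8) ^ 8 := by gcongr
    norm_num at this
    linarith
  have h4 : Real.exp (p ^ 2 / 4) = Real.exp (p ^ 2 / 8) ^ 2 := by
    rw [← Real.exp_nat_mul]; ring_nf
  have h5 : Real.exp (q ^ 2 / 4) = Real.exp (q ^ 2 / 8) ^ 2 := by
    rw [← Real.exp_nat_mul]; ring_nf
  calc _ ≤ Real.exp (1 / 8 + p ^ 2 / 8 + q ^ 2 / 8) := Real.exp_le_exp.2 h1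
    _ = Real.exp (1 / 8) * (Real.exp (p ^ 2 / 8) * Real.exp (q ^ 2 / 8)) := by
      rw [Real.exp_add, Real.exp_add]; ring
    _ ≤ 2 * (Real.exp (p ^ 2 / 8) * Real.exp (q ^ 2 / 8)) := by gcongr
    _ ≤ _ := by
      rw [h4, h5]
      nlinarith [sq_nonneg (Real.exp (p ^ 2 / 8) - Real.exp (q ^ 2 / 8))]

/-- Concentration of `quadAvg` at a single pair of vectors of the unit ball. -/
theorem exists_rate_quadAvg {f : ℝ → ℝ → ℝ} {α η : ℝ} (hα0 : 0 ≤ α) (hη : 0 < η)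
    (hf : Measurable (Function.uncurry f))
    (hα : ∀ p q, f p q ^ 2 ≤ α * (1 + p ^ 2 + q ^ 2)) :
    ∃ c : ℝ, 0 < c ∧ ∀ m n : ℕ, 0 < m → ∀ x z : EuclideanSpace ℝ (Fin n), ‖x‖ ≤ 1 → ‖z‖ ≤ 1 →
      (gaussianRows m n).real {a | ¬ |quadAvg f a x z - quadMean f x z| ≤ η} ≤
        2 * Real.exp (-c * m) := by
  set D := ∫ t, Real.exp (t ^ 2 / 4) ∂gaussianReal 0 1
  have hD : 0 ≤ D := integral_nonneg fun t => (Real.exp_pos _).le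
  obtain ⟨c, hc, h⟩ := exists_rate_abs_sum_sub_integral (s := 1 / (8 * (α + 1))) (D := D + D)
    (by positivity) (by positivity) hη
  refine ⟨c, hc, fun m n hm x z hx hz => ?_⟩
  have hmeas : Measurable fun g : EuclideanSpace ℝ (Fin n) =>
      f (inner ℝ g x) (inner ℝ g z) ^ 2 :=
    (hf.comp (f := fun g : EuclideanSpace ℝ (Fin n) => ((inner ℝ g x : ℝ), (inner ℝ g z : ℝ)))
      (by fun_prop)).pow_const 2
  have hmexp : Measurable fun g : EuclideanSpace ℝ (Fin n) =>
      Real.exp (1 / (8 * (α + 1)) * |f (inner ℝ g x) (inner ℝ g z) ^ 2|) :=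
    ((measurable_norm.comp hmeas).const_mul _).exp
  have hle : ∀ g : EuclideanSpace ℝ (Fin n),
      Real.exp (1 / (8 * (α + 1)) * |f (inner ℝ g x) (inner ℝ g z) ^ 2|) ≤
        Real.exp ((inner ℝ g x) ^ 2 / 4) + Real.exp ((inner ℝ g z) ^ 2 / 4) := fun g => by
    rw [abs_of_nonneg (sq_nonneg _)]
    exact exp_growth_le hα0 (hα _ _)
  have hint : Integrable (fun g : EuclideanSpace ℝ (Fin n) =>
      Real.exp (1 / (8 * (α + 1)) * |f (inner ℝ g x) (inner ℝ g z) ^ 2|)) (stdGaussian _) := by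
    refine ((integrable_exp_inner_sq hx).add (integrable_exp_inner_sq hz)).mono'
      hmexp.aestronglyMeasurable
      (ae_of_all _ fun g => ?_)
    rw [Real.norm_eq_abs, Real.abs_exp]
    exact hle g
  have hmp : ∀ i : Fin m, MeasurePreserving (Function.eval i) (gaussianRows m n)
      (stdGaussian (EuclideanSpace ℝ (Fin n))) := fun i =>
    measurePreserving_eval (fun _ => stdGaussian (EuclideanSpace ℝ (Fin n))) i
  have hpull : ∀ (i : Fin m) (φ : EuclideanSpace ℝ (Fin n) → ℝ), Measurable φ →
      ∫ a, φ (a i) ∂gaussianRows m n = ∫ g, φ g ∂stdGaussian (EuclideanSpace ℝ (Fin n)) := by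
    intro i φ hφ
    rw [← (hmp i).map_eq, integral_map (measurable_pi_apply i).aemeasurable
      hφ.aestronglyMeasurable]
  have key := h (Fin m → EuclideanSpace ℝ (Fin n)) (gaussianRows m n) m
    (fun i a => f (inner ℝ (a i) x) (inner ℝ (a i) z) ^ 2)
    (iIndepFun_pi fun i => hmeas.aemeasurable) (fun i => hmeas.comp (measurable_pi_apply i))
    (fun i => (hmp i).integrable_comp_of_integrable hint)
    (fun i => by
      refine (hpull i _ hmexp).trans_le ?_
      refine (integral_mono hint ((integrable_exp_inner_sq hx).add (integrable_exp_inner_sq hz))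
        hle).trans ?_
      rw [integral_add' (integrable_exp_inner_sq hx) (integrable_exp_inner_sq hz)]
      exact add_le_add (integral_exp_inner_sq_le hx) (integral_exp_inner_sq_le hz))
  convert key using 3
  ext a
  have hm' : (0 : ℝ) < m := by exact_mod_cast hm
  have : ∑ i, (f (inner ℝ (a i) x) (inner ℝ (a i) z) ^ 2 -
      ∫ a', f (inner ℝ (a' i) x) (inner ℝ (a' i) z) ^ 2 ∂gaussianRows m n) =
      (quadAvg f a x z - quadMean f x z) * m := by
    simp_rw [fun i => hpull i _ hmeas]
    rw [Finset.sum_sub_distrib, quadAvg, sub_mul, div_mul_cancel₀ _ hm'.ne']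
    simp [quadMean, mul_comm]
  rw [this, abs_mul, abs_of_pos hm', mul_le_mul_iff_left₀ hm']

/-! ### Uniform concentration over the unit ball -/

/-- Weighted AM-GM for `|a - b| |a + b|`. When `a - b` has size `ε`, both terms on the right are of
order `ε`. -/
theorem abs_sq_sub_sq_le {ε a b : ℝ} (hε : 0 < ε) :
    |a ^ 2 - b ^ 2| ≤ (a - b) ^ 2 / (2 * ε) + ε * (a ^ 2 + b ^ 2) := by
  have h1 : (a - b) ^ 2 / (2 * ε) + ε * (a ^ 2 + b ^ 2) - (a ^ 2 - b ^ 2) =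
      ((a - b) - ε * (a + b)) ^ 2 / (2 * ε) + ε * (a - b) ^ 2 / 2 := by field_simp; ring
  have h2 : (a - b) ^ 2 / (2 * ε) + ε * (a ^ 2 + b ^ 2) + (a ^ 2 - b ^ 2) =
      ((a - b) + ε * (a + b)) ^ 2 / (2 * ε) + ε * (a - b) ^ 2 / 2 := by field_simp; ring
  have h3 : 0 ≤ ((a - b) - ε * (a + b)) ^ 2 / (2 * ε) + ε * (a - b) ^ 2 / 2 := by positivity
  have h4 : 0 ≤ ((a - b) + ε * (a + b)) ^ 2 / (2 * ε) + ε * (a - b) ^ 2 / 2 := by positivity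
  rw [abs_le]
  constructor <;> linarith

/-- `f` is Lipschitz with constant `Λ` for the `ℓ¹` distance on the plane. -/
def LipschitzPair (Λ : ℝ) (f : ℝ → ℝ → ℝ) : Prop :=
  ∀ p q p' q', |f p q - f p' q'| ≤ Λ * (|p - p'| + |q - q'|)

namespace LipschitzPair

variable {Λ : ℝ} {f : ℝ → ℝ → ℝ}

theorem nonneg (hf : LipschitzPair Λ f) : 0 ≤ Λ := by
  have := (abs_nonneg _).trans (hf 1 0 0 0)
  simpa using this

theorem sq_sub_le (hf : LipschitzPair Λ f) (p q p' q' : ℝ) :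
    (f p q - f p' q') ^ 2 ≤ 2 * Λ ^ 2 * ((p - p') ^ 2 + (q - q') ^ 2) := by
  have h := pow_le_pow_left₀ (abs_nonneg _) (hf p q p' q') 2
  rw [sq_abs] at h
  refine h.trans ?_
  rw [mul_pow, ← sq_abs (p - p'), ← sq_abs (q - q')]
  nlinarith [mul_nonneg (sq_nonneg Λ) (sq_nonneg (|p - p'| - |q - q'|))]

theorem growth (hf : LipschitzPair Λ f) (p q : ℝ) :
    f p q ^ 2 ≤ (2 * f 0 0 ^ 2 + 4 * Λ ^ 2) * (1 + p ^ 2 + q ^ 2) := by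
  have h := hf.sq_sub_le p q 0 0
  simp only [sub_zero] at h
  nlinarith [sq_nonneg (f p q - 2 * f 0 0), mul_nonneg (sq_nonneg (f 0 0)) (sq_nonneg p),
    mul_nonneg (sq_nonneg (f 0 0)) (sq_nonneg q), sq_nonneg Λ]

theorem measurable (hf : LipschitzPair Λ f) : Measurable (Function.uncurry f) := by
  refine (LipschitzWith.of_dist_le_mul (K := (2 * Λ).toNNReal) fun x y => ?_).continuous.measurable
  rw [Real.coe_toNNReal _ (by linarith [hf.nonneg]), Real.dist_eq]
  refine (hf _ _ _ _).trans ?_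
  have h1 : |x.1 - y.1| ≤ dist x y := le_max_left _ _
  have h2 : |x.2 - y.2| ≤ dist x y := le_max_right _ _
  nlinarith [hf.nonneg]

end LipschitzPair

theorem abs_sq_sub_sq_le_of_lipschitzPair {Λ α ε : ℝ} {f : ℝ → ℝ → ℝ} (hε : 0 < ε)
    (hf : LipschitzPair Λ f) (hα : ∀ p q, f p q ^ 2 ≤ α * (1 + p ^ 2 + q ^ 2))
    (p q p' q' : ℝ) :
    |f p q ^ 2 - f p' q' ^ 2| ≤ Λ ^ 2 / ε * ((p - p') ^ 2 + (q - q') ^ 2) +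
      ε * α * (2 + (p ^ 2 + q ^ 2) + (p' ^ 2 + q' ^ 2)) := by
  refine (abs_sq_sub_sq_le hε).trans ?_
  have h1 : (f p q - f p' q') ^ 2 / (2 * ε) ≤ Λ ^ 2 / ε * ((p - p') ^ 2 + (q - q') ^ 2) := by
    rw [div_le_iff₀ (by positivity)]
    refine (hf.sq_sub_le p q p' q').trans_eq ?_
    field_simp
  have h2 : ε * (f p q ^ 2 + f p' q' ^ 2) ≤ ε * (α * (1 + p ^ 2 + q ^ 2) +
      α * (1 + p' ^ 2 + q' ^ 2)) := by
    gcongr <;> exact hα _ _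
  linarith

section
variable {E : Type*} [NormedAddCommGroup E] [InnerProductSpace ℝ E]

/-- Through `ha`, the displacements contribute `ε² / ε` and the sizes `ε` times a constant. -/
theorem abs_quadAvg_sub_quadAvg_le {m : ℕ} (hm : 0 < m) {Λ α ε B : ℝ} {f : ℝ → ℝ → ℝ}
    (hε : 0 < ε) (hα0 : 0 ≤ α) (hf : LipschitzPair Λ f)
    (hα : ∀ p q, f p q ^ 2 ≤ α * (1 + p ^ 2 + q ^ 2)) {a : Fin m → E}
    (ha : ∀ x, ∑ i, (inner ℝ (a i) x) ^ 2 ≤ B * m * ‖x‖ ^ 2) (hB : 0 ≤ B) {x z x' z' : E}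
    (hx : ‖x‖ ≤ 1) (hz : ‖z‖ ≤ 1) (hx' : ‖x'‖ ≤ 1) (hz' : ‖z'‖ ≤ 1)
    (hxx : ‖x - x'‖ ≤ ε) (hzz : ‖z - z'‖ ≤ ε) :
    |quadAvg f a x z - quadAvg f a x' z'| ≤ ε * (2 * B * Λ ^ 2 + (2 + 4 * B) * α) := by
  have hm' : (0 : ℝ) < m := by exact_mod_cast hm
  have hball : ∀ y : E, ‖y‖ ≤ 1 → ∑ i, (inner ℝ (a i) y) ^ 2 ≤ B * m := fun y hy =>
    (ha y).trans (mul_le_of_le_one_right (by positivity) (pow_le_one₀ (norm_nonneg _) hy))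
  have hdiff : ∀ y : E, ‖y‖ ≤ ε → ∑ i, (inner ℝ (a i) y) ^ 2 ≤ B * m * ε ^ 2 := fun y hy =>
    (ha y).trans (by gcongr)
  rw [quadAvg, quadAvg, ← sub_div, abs_div, abs_of_pos hm', div_le_iff₀ hm',
    ← Finset.sum_sub_distrib]
  refine (Finset.abs_sum_le_sum_abs _ _).trans ?_
  calc ∑ i, |f (inner ℝ (a i) x) (inner ℝ (a i) z) ^ 2 -
        f (inner ℝ (a i) x') (inner ℝ (a i) z') ^ 2|
      ≤ ∑ i, (Λ ^ 2 / ε * ((inner ℝ (a i) (x - x')) ^ 2 + (inner ℝ (a i) (z - z')) ^ 2) +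
          ε * α * (2 + ((inner ℝ (a i) x) ^ 2 + (inner ℝ (a i) z) ^ 2) +
            ((inner ℝ (a i) x') ^ 2 + (inner ℝ (a i) z') ^ 2))) := by
        refine Finset.sum_le_sum fun i _ => ?_
        rw [inner_sub_right, inner_sub_right]
        exact abs_sq_sub_sq_le_of_lipschitzPair hε hf hα _ _ _ _
    _ = Λ ^ 2 / ε * (∑ i, (inner ℝ (a i) (x - x')) ^ 2 + ∑ i, (inner ℝ (a i) (z - z')) ^ 2) +
          ε * α * (2 * m + (∑ i, (inner ℝ (a i) x) ^ 2 + ∑ i, (inner ℝ (a i) z) ^ 2) +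
            (∑ i, (inner ℝ (a i) x') ^ 2 + ∑ i, (inner ℝ (a i) z') ^ 2)) := by
        simp only [Finset.sum_add_distrib, ← Finset.mul_sum, Finset.sum_const, Finset.card_univ,
          Fintype.card_fin, nsmul_eq_mul]
        ring
    _ ≤ Λ ^ 2 / ε * (B * m * ε ^ 2 + B * m * ε ^ 2) +
          ε * α * (2 * m + (B * m + B * m) + (B * m + B * m)) := by
        gcongr
        exacts [hdiff _ hxx, hdiff _ hzz, hball _ hx, hball _ hz, hball _ hx', hball _ hz']
    _ = _ := by field_simp; ring

variable [FiniteDimensional ℝ E] [MeasurableSpace E] [BorelSpace E]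

/-- The perturbation estimate for averages, with `E ⟪g, y⟫² = ‖y‖²` in the role of the operator norm
bound. -/
theorem abs_quadMean_sub_quadMean_le {Λ α ε : ℝ} {f : ℝ → ℝ → ℝ}
    (hε : 0 < ε) (hα0 : 0 ≤ α) (hf : LipschitzPair Λ f)
    (hα : ∀ p q, f p q ^ 2 ≤ α * (1 + p ^ 2 + q ^ 2)) {x z x' z' : E}
    (hx : ‖x‖ ≤ 1) (hz : ‖z‖ ≤ 1) (hx' : ‖x'‖ ≤ 1) (hz' : ‖z'‖ ≤ 1)
    (hxx : ‖x - x'‖ ≤ ε) (hzz : ‖z - z'‖ ≤ ε) :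
    |quadMean f x z - quadMean f x' z'| ≤ ε * (2 * Λ ^ 2 + 6 * α) := by
  have hI := fun y : E => integrable_inner_pow_stdGaussian y 2
  have hsq : ∀ {r s : ℝ} {y : E}, ‖y‖ ≤ r → ‖y‖ ^ 2 ≤ r ^ 2 := fun h => by gcongr
  rw [quadMean, quadMean, ← integral_sub (integrable_sq_of_growth hf.measurable hα x z)
    (integrable_sq_of_growth hf.measurable hα x' z')]
  refine (abs_integral_le_integral_abs).trans ?_
  have hI2 : ∀ y w : E, Integrable (fun g => (inner ℝ g y) ^ 2 + (inner ℝ g w) ^ 2)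
      (stdGaussian E) := fun y w => (hI y).add (hI w)
  have hI2v : ∀ y w : E, ∫ g, (inner ℝ g y) ^ 2 + (inner ℝ g w) ^ 2 ∂stdGaussian E =
      ‖y‖ ^ 2 + ‖w‖ ^ 2 := fun y w => by
    rw [integral_add (hI y) (hI w), integral_inner_sq_stdGaussian, integral_inner_sq_stdGaussian]
  have h1 : Integrable (fun g : E => Λ ^ 2 / ε *
      ((inner ℝ g (x - x')) ^ 2 + (inner ℝ g (z - z')) ^ 2)) (stdGaussian E) :=
    (hI2 _ _).const_mul _
  have h3 : Integrable (fun g : E => 2 + ((inner ℝ g x) ^ 2 + (inner ℝ g z) ^ 2))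
      (stdGaussian E) := (integrable_const _).add (hI2 _ _)
  have h2 : Integrable (fun g : E => ε * α * (2 + ((inner ℝ g x) ^ 2 + (inner ℝ g z) ^ 2) +
      ((inner ℝ g x') ^ 2 + (inner ℝ g z') ^ 2))) (stdGaussian E) :=
    (h3.add (hI2 _ _)).const_mul _
  calc ∫ g, |f (inner ℝ g x) (inner ℝ g z) ^ 2 -
        f (inner ℝ g x') (inner ℝ g z') ^ 2| ∂stdGaussian E
      ≤ ∫ g, (Λ ^ 2 / ε * ((inner ℝ g (x - x')) ^ 2 + (inner ℝ g (z - z')) ^ 2) +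
          ε * α * (2 + ((inner ℝ g x) ^ 2 + (inner ℝ g z) ^ 2) +
            ((inner ℝ g x') ^ 2 + (inner ℝ g z') ^ 2))) ∂stdGaussian E := by
        refine integral_mono ((integrable_sq_of_growth hf.measurable hα x z).sub
          (integrable_sq_of_growth hf.measurable hα x' z')).abs (h1.add h2) fun g => ?_
        rw [inner_sub_right, inner_sub_right]
        exact abs_sq_sub_sq_le_of_lipschitzPair hε hf hα _ _ _ _
    _ = Λ ^ 2 / ε * (‖x - x'‖ ^ 2 + ‖z - z'‖ ^ 2) +
          ε * α * (2 + (‖x‖ ^ 2 + ‖z‖ ^ 2) + (‖x'‖ ^ 2 + ‖z'‖ ^ 2)) := by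
        rw [integral_add h1 h2, integral_const_mul, integral_const_mul,
          integral_add h3 (hI2 _ _), integral_add (integrable_const _) (hI2 _ _), hI2v, hI2v, hI2v]
        simp
    _ ≤ Λ ^ 2 / ε * (ε ^ 2 + ε ^ 2) + ε * α * (2 + (1 ^ 2 + 1 ^ 2) + (1 ^ 2 + 1 ^ 2)) := by
        gcongr
    _ = _ := by field_simp; ring
end

/-- With overwhelming probability `‖A x‖² ≤ 8 m ‖x‖²` for all `x`. -/
theorem overwhelming_sum_inner_sq_le :
    Overwhelming fun m _ a => ∀ x, ∑ i, (inner ℝ (a i) x) ^ 2 ≤ 8 * m * ‖x‖ ^ 2 := by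
  choose N hN1 hN2 hN3 using fun n : ℕ =>
    exists_finset_net_unitBall (EuclideanSpace ℝ (Fin n)) (ε := 1 / 2) (by norm_num)
  have hlip : LipschitzPair 1 fun p _ => p := fun p q p' q' => by
    linarith [abs_nonneg (q - q')]
  obtain ⟨c, hc, h⟩ := exists_rate_quadAvg (f := fun p _ => p) (η := 1)
    (by positivity) one_pos hlip.measurable hlip.growth
  have key := Overwhelming.forall_mem (c := c) (L := 1 + 2 / (1 / 2)) hc (by norm_num) N
    (fun n => by simpa using hN2 n)
    (R := fun m n x a => |quadAvg (fun p _ => p) a x x - quadMean (fun p _ => p) x x| ≤ 1)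
    (fun m n hm x hx => h m n hm x x (hN1 n x hx) (hN1 n x hx))
  refine key.mono fun m n a hn hm hQ x => ?_
  have hm' : (0 : ℝ) < m := by exact_mod_cast hm
  let T : EuclideanSpace ℝ (Fin n) →L[ℝ] EuclideanSpace ℝ (Fin m) :=
    LinearMap.toContinuousLinearMap
      { toFun := fun x => WithLp.toLp 2 fun i => inner ℝ (a i) x
        map_add' := fun x y => by ext i; simp [inner_add_right]
        map_smul' := fun r x => by ext i; simp [inner_smul_right] }
  have hT : ∀ y, ‖T y‖ ^ 2 = ∑ i, (inner ℝ (a i) y) ^ 2 := fun y => by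
    rw [EuclideanSpace.real_norm_sq_eq]; rfl
  have hTN : ∀ y ∈ N n, ‖T y‖ ≤ √(2 * m) := fun y hy => by
    refine Real.le_sqrt_of_sq_le ?_
    have h1 := (abs_le.1 (hQ y hy)).2
    have h2 : quadMean (fun p _ => p) y y ≤ 1 := by
      rw [quadMean, integral_inner_sq_stdGaussian]
      exact pow_le_one₀ (norm_nonneg _) (hN1 n y hy)
    have h3 : quadAvg (fun p _ => p) a y y ≤ 2 := by linarith
    rw [quadAvg, div_le_iff₀ hm'] at h3
    rw [hT]
    exact h3
  -- A net of mesh `1 / 2` costs half of `‖T‖`, which is then moved to the left; squaring `2 √(2m)`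
  -- yields the constant 8.
  have hnorm : ‖T‖ ≤ √(2 * m) + ‖T‖ * (1 / 2) := by
    refine T.opNorm_le_of_unit_norm (by positivity) fun y hy => ?_
    obtain ⟨y', hy', hyy⟩ := hN3 n y hy.le
    calc ‖T y‖ = ‖T y' + T (y - y')‖ := by rw [map_sub]; congr 1; abel
      _ ≤ ‖T y'‖ + ‖T (y - y')‖ := norm_add_le _ _
      _ ≤ √(2 * m) + ‖T‖ * (1 / 2) :=
        add_le_add (hTN y' hy') ((T.le_opNorm _).trans (by gcongr))
  have hnorm2 : ‖T‖ ≤ 2 * √(2 * m) := by linarith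
  have hx : ‖T x‖ ≤ 2 * √(2 * m) * ‖x‖ := (T.le_opNorm x).trans (by gcongr)
  have hx2 := pow_le_pow_left₀ (norm_nonneg _) hx 2
  rw [hT, mul_pow, mul_pow, Real.sq_sqrt (by positivity)] at hx2
  linarith

/-- Uniform concentration of quadratic empirical averages of a Lipschitz function of two linear
functionals. -/
theorem overwhelming_quadAvg {Λ : ℝ} {f : ℝ → ℝ → ℝ} (hf : LipschitzPair Λ f) {η : ℝ}
    (hη : 0 < η) :
    Overwhelming fun _ _ a => ∀ x z, ‖x‖ ≤ 1 → ‖z‖ ≤ 1 →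
      |quadAvg f a x z - quadMean f x z| ≤ η := by
  set α := 2 * f 0 0 ^ 2 + 4 * Λ ^ 2 with hαdef
  have hα0 : 0 ≤ α := by positivity
  -- The perturbation constants of average (with `B = 8`) and mean. The mesh `ε` makes their total
  -- at most `η / 2`, and the other half is the deviation on the net.
  set W := (2 * 8 * Λ ^ 2 + (2 + 4 * 8) * α) + (2 * Λ ^ 2 + 6 * α) with hW
  have hW0 : 0 ≤ W := by positivity
  set ε := η / (2 * (W + 1)) with hε
  have hε0 : 0 < ε := by positivity
  have hεW : ε * W ≤ η / 2 := by
    rw [hε, div_mul_eq_mul_div, div_le_iff₀ (by positivity)]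
    nlinarith
  choose N hN1 hN2 hN3 using fun n : ℕ =>
    exists_finset_net_unitBall (EuclideanSpace ℝ (Fin n)) hε0
  obtain ⟨c, hc, h⟩ := exists_rate_quadAvg (f := f) (η := η / 2) hα0 (by positivity)
    hf.measurable hf.growth
  have hL : 1 ≤ 1 + 2 / ε := by
    have : 0 < 2 / ε := by positivity
    linarith
  have key := Overwhelming.forall_mem (c := c) (L := (1 + 2 / ε) * (1 + 2 / ε)) hc
    (one_le_mul_of_one_le_of_one_le hL hL) (fun n => N n ×ˢ N n)
    (fun n => by
      have := hN2 n
      rw [finrank_euclideanSpace_fin] at this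
      rw [Finset.card_product, Nat.cast_mul, mul_pow]
      gcongr)
    (R := fun m n t a => |quadAvg f a t.1 t.2 - quadMean f t.1 t.2| ≤ η / 2)
    (fun m n hm t ht => by
      rw [Finset.mem_product] at ht
      exact h m n hm t.1 t.2 (hN1 n _ ht.1) (hN1 n _ ht.2))
  refine (key.and overwhelming_sum_inner_sq_le).mono fun m n a hn hm ⟨hQ, ha⟩ x z hx hz => ?_
  obtain ⟨x', hx', hxx⟩ := hN3 n x hx
  obtain ⟨z', hz', hzz⟩ := hN3 n z hz
  have h1 := abs_quadAvg_sub_quadAvg_le hm hε0 hα0 hf hf.growth ha (by norm_num) hx hz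
    (hN1 n x' hx') (hN1 n z' hz') hxx hzz
  have h2 := abs_quadMean_sub_quadMean_le hε0 hα0 hf hf.growth hx hz
    (hN1 n x' hx') (hN1 n z' hz') hxx hzz
  have h3 := hQ (x', z') (Finset.mk_mem_product hx' hz')
  have h4 : ε * (2 * 8 * Λ ^ 2 + (2 + 4 * 8) * α) + ε * (2 * Λ ^ 2 + 6 * α) ≤ η / 2 := by
    rw [← mul_add]; exact hεW
  simp only at h3
  rw [abs_le] at h1 h2 h3 ⊢
  constructor <;> linarith [h1.1, h1.2, h2.1, h2.2, h3.1, h3.2]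

/-! ### Symmetrization and the mean ReLU increment -/

section
variable {E : Type*} [NormedAddCommGroup E] [InnerProductSpace ℝ E] [FiniteDimensional ℝ E]
  [MeasurableSpace E] [BorelSpace E] {f : ℝ → ℝ → ℝ} {Λ : ℝ}

theorem integrable_symm_sq (hf : LipschitzPair Λ f) (x z : E) :
    Integrable (fun g => f (inner ℝ g x) (inner ℝ g z) ^ 2 +
      f (-inner ℝ g x) (-inner ℝ g z) ^ 2) (stdGaussian E) := by
  have h := integrable_sq_of_growth hf.measurable hf.growth (-x) (-z)
  simp only [inner_neg_right] at h
  exact (integrable_sq_of_growth hf.measurable hf.growth x z).add h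

/-- Symmetrization of `quadMean` under `g ↦ -g`. -/
theorem two_mul_quadMean (hf : LipschitzPair Λ f) (x z : E) :
    2 * quadMean f x z = ∫ g, (f (inner ℝ g x) (inner ℝ g z) ^ 2 +
      f (-inner ℝ g x) (-inner ℝ g z) ^ 2) ∂stdGaussian E := by
  have h := integrable_sq_of_growth hf.measurable hf.growth (-x) (-z)
  have h' := integral_stdGaussian_comp_neg (fun g : E => f (inner ℝ g x) (inner ℝ g z) ^ 2)
  simp only [inner_neg_right, inner_neg_left] at h h'
  rw [integral_add (integrable_sq_of_growth hf.measurable hf.growth x z) h, h', quadMean]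
  ring
end

theorem abs_max_zero_sub_max_zero_le (p q : ℝ) : |max 0 p - max 0 q| ≤ |p - q| := by
  rcases max_cases 0 p with ⟨h1, h2⟩ | ⟨h1, h2⟩ <;> rcases max_cases 0 q with ⟨h3, h4⟩ | ⟨h3, h4⟩ <;>
    rw [h1, h3] <;> rw [abs_le] <;> constructor <;>
    rcases abs_cases (p - q) with ⟨h5, h6⟩ | ⟨h5, h6⟩ <;> linarith

/-- The increment of the ReLU function. -/
noncomputable def reluDiff (p q : ℝ) : ℝ := max 0 p - max 0 q

theorem lipschitzPair_reluDiff : LipschitzPair 1 reluDiff := fun p q p' q' => by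
  have h1 := abs_max_zero_sub_max_zero_le p p'
  have h2 := abs_max_zero_sub_max_zero_le q q'
  calc |reluDiff p q - reluDiff p' q'|
      = |(max 0 p - max 0 p') - (max 0 q - max 0 q')| := by rw [reluDiff, reluDiff]; ring_nf
    _ ≤ |max 0 p - max 0 p'| + |max 0 q - max 0 q'| := abs_sub _ _
    _ ≤ _ := by linarith

/-- For equal signs one term is `(p - q)²` and the other vanishes. For opposite signs the sum is `p²
+ q²`, while `|p - q| = |p| + |q|`. -/
theorem reluDiff_symm_bounds (p q : ℝ) :
    (p - q) ^ 2 / 2 ≤ reluDiff p q ^ 2 + reluDiff (-p) (-q) ^ 2 ∧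
      reluDiff p q ^ 2 + reluDiff (-p) (-q) ^ 2 ≤ (p - q) ^ 2 := by
  unfold reluDiff
  rcases le_total 0 p with hp | hp <;> rcases le_total 0 q with hq | hq
  · rw [max_eq_right hp, max_eq_right hq, max_eq_left (by linarith : -p ≤ 0),
      max_eq_left (by linarith : -q ≤ 0)]
    constructor <;> nlinarith [sq_nonneg (p - q)]
  · rw [max_eq_right hp, max_eq_left hq, max_eq_left (by linarith : -p ≤ 0),
      max_eq_right (by linarith : 0 ≤ -q)]
    constructor <;> nlinarith [sq_nonneg (p + q), mul_nonneg hp (neg_nonneg.2 hq)]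
  · rw [max_eq_left hp, max_eq_right hq, max_eq_right (by linarith : 0 ≤ -p),
      max_eq_left (by linarith : -q ≤ 0)]
    constructor <;> nlinarith [sq_nonneg (p + q), mul_nonneg hq (neg_nonneg.2 hp)]
  · rw [max_eq_left hp, max_eq_left hq, max_eq_right (by linarith : 0 ≤ -p),
      max_eq_right (by linarith : 0 ≤ -q)]
    constructor <;> nlinarith [sq_nonneg (p - q)]

section
variable {E : Type*} [NormedAddCommGroup E] [InnerProductSpace ℝ E] [FiniteDimensional ℝ E]
  [MeasurableSpace E] [BorelSpace E]

theorem quadMean_reluDiff_bounds (x y : E) :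
    ‖x - y‖ ^ 2 / 4 ≤ quadMean reluDiff x y ∧ quadMean reluDiff x y ≤ ‖x - y‖ ^ 2 / 2 := by
  have h := two_mul_quadMean lipschitzPair_reluDiff x y
  have hi := integrable_symm_sq lipschitzPair_reluDiff x y
  have hd := integrable_inner_pow_stdGaussian (x - y) 2
  have h1 := integral_mono (hd.div_const 2) hi fun g => by
    simp only [inner_sub_right]; exact (reluDiff_symm_bounds _ _).1
  have h2 := integral_mono hi hd fun g => by
    simp only [inner_sub_right]; exact (reluDiff_symm_bounds _ _).2
  rw [integral_div] at h1
  rw [integral_inner_sq_stdGaussian, ← h] at h1 h2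
  constructor <;> linarith
end

/-! ### Linearization for close pairs -/

/-- A Lipschitz substitute for `𝟙 (p > 0) * q`, truncated at height `K`. -/
noncomputable def gate (τ K p q : ℝ) : ℝ :=
  max 0 (min 1 (p / τ)) * max (-K) (min K q)

/-- A Lipschitz majorant of the error made when `𝟙 (p > 0) * q` is replaced by `gate`. -/
noncomputable def gateError (τ K p q : ℝ) : ℝ :=
  2 * max 0 (|q| - K / 2) + K * max 0 (2 - |p| / τ)

/-- Product rule; the truncation at `K` bounds the factor that multiplies the slope `1 / τ`. -/
theorem lipschitzPair_gate {τ K : ℝ} (hτ : 0 < τ) (hK : 0 < K) :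
    LipschitzPair (1 + K / τ) (gate τ K) := fun p q p' q' => by
  have h1 : |max 0 (min 1 (p / τ)) - max 0 (min 1 (p' / τ))| ≤ |p - p'| / τ := by
    refine (abs_max_zero_sub_max_zero_le _ _).trans ?_
    have := abs_min_sub_min_le_max 1 (p / τ) 1 (p' / τ)
    rw [sub_self, abs_zero, max_eq_right (abs_nonneg _), ← sub_div, abs_div, abs_of_pos hτ] at this
    exact this
  have h2 : |max (-K) (min K q) - max (-K) (min K q')| ≤ |q - q'| := by
    have h3 := abs_max_sub_max_le_max (-K) (min K q) (-K) (min K q')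
    have h4 := abs_min_sub_min_le_max K q K q'
    rw [sub_self, abs_zero, max_eq_right (abs_nonneg (min K q - min K q'))] at h3
    rw [sub_self, abs_zero, max_eq_right (abs_nonneg _)] at h4
    exact h3.trans h4
  have h5 : |max 0 (min 1 (p / τ))| ≤ 1 := by
    rw [abs_of_nonneg (le_max_left _ _)]
    exact max_le zero_le_one (min_le_left _ _)
  have h6 : |max (-K) (min K q')| ≤ K :=
    abs_le.2 ⟨le_max_left _ _, max_le (by linarith) (min_le_left _ _)⟩
  have h7 : 0 ≤ |p - p'| / τ := by positivity
  calc |gate τ K p q - gate τ K p' q'|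
      = |max 0 (min 1 (p / τ)) * (max (-K) (min K q) - max (-K) (min K q')) +
          (max 0 (min 1 (p / τ)) - max 0 (min 1 (p' / τ))) * max (-K) (min K q')| := by
        rw [gate, gate]; ring_nf
    _ ≤ 1 * |q - q'| + |p - p'| / τ * K := by
        refine (abs_add_le _ _).trans ?_
        rw [abs_mul, abs_mul]
        gcongr
    _ ≤ _ := by
        have h8 : 0 ≤ K / τ * |q - q'| := by positivity
        have h9 : |p - p'| / τ * K = K / τ * |p - p'| := by ring
        linarith [abs_nonneg (p - p')]

theorem lipschitzPair_gateError {τ K : ℝ} (hτ : 0 < τ) (hK : 0 < K) :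
    LipschitzPair (2 + K / τ) (gateError τ K) := fun p q p' q' => by
  have h1 : |max 0 (2 - |p| / τ) - max 0 (2 - |p'| / τ)| ≤ |p - p'| / τ := by
    refine (abs_max_zero_sub_max_zero_le _ _).trans ?_
    rw [sub_sub_sub_cancel_left, ← sub_div, abs_div, abs_of_pos hτ, abs_sub_comm p p']
    exact div_le_div_of_nonneg_right (abs_abs_sub_abs_le p' p) hτ.le
  have h2 : |max 0 (|q| - K / 2) - max 0 (|q'| - K / 2)| ≤ |q - q'| := by
    refine (abs_max_zero_sub_max_zero_le _ _).trans ?_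
    rw [sub_sub_sub_cancel_right]
    exact abs_abs_sub_abs_le q q'
  calc |gateError τ K p q - gateError τ K p' q'|
      = |2 * (max 0 (|q| - K / 2) - max 0 (|q'| - K / 2)) +
          K * (max 0 (2 - |p| / τ) - max 0 (2 - |p'| / τ))| := by
        rw [gateError, gateError]; ring_nf
    _ ≤ 2 * |q - q'| + K * (|p - p'| / τ) := by
        refine (abs_add_le _ _).trans ?_
        rw [abs_mul, abs_mul, abs_of_pos hK, abs_two]
        gcongr
    _ ≤ _ := by
        have h8 : 0 ≤ K / τ * |q - q'| := by positivity
        have h9 : K * (|p - p'| / τ) = K / τ * |p - p'| := by ring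
        linarith [abs_nonneg (p - p')]

theorem gateError_nonneg {τ K : ℝ} (hK : 0 < K) (p q : ℝ) : 0 ≤ gateError τ K p q := by
  unfold gateError; positivity

/-- If `|q| ≥ K` then `2 (|q| - K / 2) ≥ |q|`. Otherwise `|p| ≤ τ` makes the second summand at least
`K > |q|`. -/
theorem abs_le_gateError {τ K : ℝ} (hτ : 0 < τ) (hK : 0 < K) {p q : ℝ}
    (h : K ≤ |q| ∨ |p| ≤ τ) : |q| ≤ gateError τ K p q := by
  unfold gateError
  by_cases hq : K ≤ |q|
  · have h1 := le_max_right 0 (|q| - K / 2)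
    have h2 : 0 ≤ K * max 0 (2 - |p| / τ) := by positivity
    linarith
  · have hp : |p| / τ ≤ 1 := (div_le_one hτ).2 (h.resolve_left hq)
    have h1 : 1 ≤ max 0 (2 - |p| / τ) := le_max_of_le_right (by linarith)
    have h2 := le_max_left 0 (|q| - K / 2)
    nlinarith

theorem abs_gate_le {τ K : ℝ} (hK : 0 < K) (p q : ℝ) : |gate τ K p q| ≤ |q| := by
  have h5 : |max 0 (min 1 (p / τ))| ≤ 1 := by
    rw [abs_of_nonneg (le_max_left _ _)]
    exact max_le zero_le_one (min_le_left _ _)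
  have h6 : |max (-K) (min K q)| ≤ |q| := by
    rw [abs_le]
    constructor
    · rcases le_total 0 q with hq | hq
      · exact le_max_of_le_right (le_min (by linarith [abs_nonneg q]) (by linarith [abs_nonneg q]))
      · exact le_max_of_le_right (le_min (by linarith [abs_nonneg q]) (neg_abs_le q))
    · exact max_le (by linarith [abs_nonneg q]) ((min_le_right _ _).trans (le_abs_self q))
  rw [gate, abs_mul]
  calc _ ≤ 1 * |q| := by gcongr
    _ = _ := one_mul _

theorem gate_of_le {τ K p q : ℝ} (hτ : 0 < τ) (hp : τ ≤ p) (hq : |q| ≤ K) :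
    gate τ K p q = q := by
  rw [abs_le] at hq
  rw [gate, min_eq_left ((one_le_div hτ).2 hp), max_eq_right zero_le_one, min_eq_right hq.2,
    max_eq_right hq.1, one_mul]

theorem gate_of_nonpos {τ K p q : ℝ} (hτ : 0 < τ) (hp : p ≤ 0) : gate τ K p q = 0 := by
  have : p / τ ≤ 0 := div_nonpos_of_nonpos_of_nonneg hp hτ.le
  rw [gate, min_eq_right (by linarith), max_eq_left this, zero_mul]

/-- One of the two gates is always closed. If `|p| > τ` and `|q| < K` the other returns `q` up to
sign; in all other cases the error term alone dominates `q²`. -/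
theorem gate_symm_bounds {τ K : ℝ} (hτ : 0 < τ) (hK : 0 < K) (p q : ℝ) :
    q ^ 2 - gateError τ K p q ^ 2 ≤ gate τ K p q ^ 2 + gate τ K (-p) (-q) ^ 2 ∧
      gate τ K p q ^ 2 + gate τ K (-p) (-q) ^ 2 ≤ q ^ 2 := by
  constructor
  · by_cases h : K ≤ |q| ∨ |p| ≤ τ
    · have h1 := pow_le_pow_left₀ (abs_nonneg _) (abs_le_gateError hτ hK h) 2
      rw [sq_abs] at h1
      nlinarith [sq_nonneg (gate τ K p q), sq_nonneg (gate τ K (-p) (-q))]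
    · push Not at h
      rcases lt_abs.1 h.2 with hp | hp
      · rw [gate_of_le hτ hp.le h.1.le]
        nlinarith [sq_nonneg (gateError τ K p q), sq_nonneg (gate τ K (-p) (-q))]
      · rw [gate_of_le hτ hp.le (q := -q) (by rw [abs_neg]; exact h.1.le)]
        nlinarith [sq_nonneg (gateError τ K p q), sq_nonneg (gate τ K p q)]
  · rcases le_total p 0 with hp | hp
    · have h1 := pow_le_pow_left₀ (abs_nonneg _) (abs_gate_le (τ := τ) hK (-p) (-q)) 2
      rw [sq_abs, sq_abs, neg_sq] at h1
      rw [gate_of_nonpos hτ hp]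
      linarith
    · have h1 := pow_le_pow_left₀ (abs_nonneg _) (abs_gate_le (τ := τ) hK p q) 2
      rw [sq_abs, sq_abs] at h1
      rw [gate_of_nonpos (p := -p) hτ (by linarith)]
      linarith

/-- For short increments the ReLU difference is close to the linearized gate. -/
theorem abs_abs_reluDiff_sub_gate_le {τ K t : ℝ} (hτ : 0 < τ) (hK : 0 < K) (ht : 0 < t)
    (htK : t * K ≤ τ) (p q : ℝ) :
    |(|reluDiff p (p - t * q)| - t * |gate τ K p q|)| ≤ t * gateError τ K p q := by
  by_cases h : K ≤ |q| ∨ |p| ≤ τ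
  · have h1 := abs_le_gateError hτ hK h
    have h2 := abs_max_zero_sub_max_zero_le p (p - t * q)
    rw [sub_sub_cancel, abs_mul, abs_of_pos ht] at h2
    have h3 := mul_le_mul_of_nonneg_left (abs_gate_le (τ := τ) hK p q) ht.le
    have h4 := mul_le_mul_of_nonneg_left h1 ht.le
    have h5 : 0 ≤ t * |gate τ K p q| := by positivity
    have h6 := abs_nonneg (reluDiff p (p - t * q))
    rw [← reluDiff] at h2
    rw [abs_le]
    constructor <;> linarith
  · push Not at h
    have h0 := mul_nonneg ht.le (gateError_nonneg (τ := τ) hK p q)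
    -- Since `|t q| ≤ τ < |p|`, the segment from `p` to `p - t q` does not cross the kink.
    have htq : |t * q| ≤ τ := by
      rw [abs_mul, abs_of_pos ht]
      exact (mul_le_mul_of_nonneg_left h.1.le ht.le).trans htK
    rw [abs_le] at htq
    rcases lt_abs.1 h.2 with hp | hp
    · rw [gate_of_le hτ hp.le h.1.le, reluDiff, max_eq_right (by linarith),
        max_eq_right (by linarith [htq.2]), sub_sub_cancel, abs_mul, abs_of_pos ht, sub_self,
        abs_zero]
      exact h0
    · rw [gate_of_nonpos hτ (by linarith), reluDiff, max_eq_left (by linarith),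
        max_eq_left (by linarith [htq.1])]
      simpa using h0

section
variable {E : Type*} [NormedAddCommGroup E] [InnerProductSpace ℝ E] [FiniteDimensional ℝ E]
  [MeasurableSpace E] [BorelSpace E]

theorem quadMean_gate_bounds {τ K : ℝ} (hτ : 0 < τ) (hK : 0 < K) (x z : E) :
    (‖z‖ ^ 2 - quadMean (gateError τ K) x z) / 2 ≤ quadMean (gate τ K) x z ∧
      quadMean (gate τ K) x z ≤ ‖z‖ ^ 2 / 2 := by
  have hg := lipschitzPair_gate hτ hK
  have he := lipschitzPair_gateError hτ hK
  have h := two_mul_quadMean hg x z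
  have hi := integrable_symm_sq hg x z
  have hd := integrable_inner_pow_stdGaussian z 2
  have hei := integrable_sq_of_growth he.measurable he.growth x z
  have h1 := integral_mono (hd.sub hei) hi fun g => (gate_symm_bounds hτ hK _ _).1
  have h2 := integral_mono hi hd fun g => (gate_symm_bounds hτ hK _ _).2
  rw [integral_sub' hd hei] at h1
  rw [integral_inner_sq_stdGaussian, ← h] at h1 h2
  rw [quadMean] at h1 ⊢
  rw [quadMean] at h2 ⊢
  constructor <;> linarith
end

theorem gaussianReal_Icc_le {r : ℝ} (hr : 0 ≤ r) :
    (gaussianReal 0 1).real (Set.Icc (-r) r) ≤ 2 * r := by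
  rw [measureReal_def, gaussianReal_apply 0 one_ne_zero]
  refine ENNReal.toReal_le_of_le_ofReal (by positivity) ?_
  calc ∫⁻ x in Set.Icc (-r) r, gaussianPDF 0 1 x
      ≤ ∫⁻ _ in Set.Icc (-r) r, 1 := by
        refine lintegral_mono fun x => ?_
        rw [gaussianPDF, ← ENNReal.ofReal_one]
        refine ENNReal.ofReal_le_ofReal ?_
        rw [gaussianPDFReal]
        refine mul_le_one₀ (inv_le_one_of_one_le₀ ?_) (Real.exp_pos _).le (Real.exp_le_one_iff.2 ?_)
        · rw [Real.one_le_sqrt]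
          simp only [NNReal.coe_one, mul_one]
          linarith [Real.pi_gt_three]
        · simp only [NNReal.coe_one, mul_one, sub_zero]
          linarith [sq_nonneg x]
    _ = ENNReal.ofReal (2 * r) := by
        rw [setLIntegral_one, Real.volume_Icc]; ring_nf

/-- The first summand lives on `|q| ≥ K / 2`, where `q² ≤ 4 q⁴ / K²`; the second lives on `|p| ≤ 2
τ` and is at most `2 K`. -/
theorem gateError_sq_le {τ K : ℝ} (hτ : 0 < τ) (hK : 0 < K) (p q : ℝ) :
    gateError τ K p q ^ 2 ≤ 32 / K ^ 2 * q ^ 4 +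
      8 * K ^ 2 * (Set.Icc (-(2 * τ)) (2 * τ)).indicator (fun _ => 1) p := by
  have h1 : max 0 (|q| - K / 2) ^ 2 ≤ 4 / K ^ 2 * q ^ 4 := by
    rcases le_total (|q| - K / 2) 0 with h | h
    · rw [max_eq_left h, zero_pow two_ne_zero]
      positivity
    · rw [max_eq_right h, div_mul_eq_mul_div, le_div_iff₀ (by positivity)]
      have h2 : q ^ 4 = |q| ^ 2 * |q| ^ 2 := by rw [sq_abs]; ring
      have h3 : (|q| - K / 2) ^ 2 ≤ |q| ^ 2 := by gcongr; linarith
      have h4 : K ^ 2 ≤ 4 * |q| ^ 2 := by nlinarith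
      rw [h2]
      nlinarith [mul_le_mul h3 h4 (sq_nonneg K) (sq_nonneg |q|)]
  have h2 : max 0 (2 - |p| / τ) ^ 2 ≤
      4 * (Set.Icc (-(2 * τ)) (2 * τ)).indicator (fun _ => (1 : ℝ)) p := by
    by_cases hp : |p| ≤ 2 * τ
    · rw [Set.indicator_of_mem (Set.mem_Icc.2 (abs_le.1 hp))]
      have h3 : max 0 (2 - |p| / τ) ≤ 2 := max_le (by norm_num) (by
        have : 0 ≤ |p| / τ := by positivity
        linarith)
      nlinarith [le_max_left 0 (2 - |p| / τ)]
    · rw [Set.indicator_of_notMem (fun h => hp (abs_le.2 (Set.mem_Icc.1 h))), max_eq_left]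
      · norm_num
      · rw [sub_nonpos, le_div_iff₀ hτ]
        linarith
  unfold gateError
  calc _ ≤ 2 * (2 * max 0 (|q| - K / 2)) ^ 2 + 2 * (K * max 0 (2 - |p| / τ)) ^ 2 := by
        nlinarith [sq_nonneg (2 * max 0 (|q| - K / 2) - K * max 0 (2 - |p| / τ))]
    _ = 8 * max 0 (|q| - K / 2) ^ 2 + 2 * K ^ 2 * max 0 (2 - |p| / τ) ^ 2 := by ring
    _ ≤ 8 * (4 / K ^ 2 * q ^ 4) + 2 * K ^ 2 *
        (4 * (Set.Icc (-(2 * τ)) (2 * τ)).indicator (fun _ => (1 : ℝ)) p) := by gcongr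
    _ = _ := by ring

/-- The linearization error has arbitrarily small second moment, uniformly over unit vectors. -/
theorem exists_quadMean_gateError_le {κ : ℝ} (hκ : 0 < κ) :
    ∃ τ : ℝ, 0 < τ ∧ ∃ K : ℝ, 0 < K ∧ ∀ (n : ℕ) (x z : EuclideanSpace ℝ (Fin n)),
      ‖x‖ = 1 → ‖z‖ = 1 → quadMean (gateError τ K) x z ≤ κ := by
  set M := ∫ t : ℝ, t ^ 4 ∂gaussianReal 0 1
  have hM : 0 ≤ M := integral_nonneg fun t => by positivity
  set K := 1 + 64 * M / κ with hKdef
  have hK1 : 1 ≤ K := le_add_of_nonneg_right (by positivity)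
  have hK : 0 < K := by linarith
  have hKM : 32 / K ^ 2 * M ≤ κ / 2 := by
    rw [div_mul_eq_mul_div, div_le_iff₀ (by positivity)]
    have h1 : 64 * M / κ ≤ K ^ 2 := by nlinarith
    rw [div_le_iff₀ hκ] at h1
    linarith
  -- `K` was fixed first to tame the fourth moment; `τ` then makes the strip `|p| ≤ 2 τ` contribute
  -- at most `κ / 2`.
  set τ := κ / (64 * K ^ 2) with hτdef
  have hτ : 0 < τ := by positivity
  have hKτ : 8 * K ^ 2 * (2 * (2 * τ)) = κ / 2 := by
    rw [hτdef]; field_simp; ring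
  refine ⟨τ, hτ, K, hK, fun n x z hx hz => ?_⟩
  have he := lipschitzPair_gateError hτ hK
  have hind : Measurable ((Set.Icc (-(2 * τ)) (2 * τ)).indicator fun _ => (1 : ℝ)) :=
    measurable_const.indicator measurableSet_Icc
  have hiind : Integrable (fun g : EuclideanSpace ℝ (Fin n) =>
      (Set.Icc (-(2 * τ)) (2 * τ)).indicator (fun _ => (1 : ℝ)) (inner ℝ g x)) (stdGaussian _) := by
    rw [integrable_inner_stdGaussian_iff x hind, hx]
    simp only [one_mul]
    exact (integrable_const _).indicator measurableSet_Icc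
  have hi4 := integrable_inner_pow_stdGaussian z 4
  rw [quadMean]
  refine (integral_mono (integrable_sq_of_growth he.measurable he.growth x z)
    ((hi4.const_mul (32 / K ^ 2)).add (hiind.const_mul (8 * K ^ 2)))
    fun g => gateError_sq_le hτ hK _ _).trans ?_
  rw [integral_add' (hi4.const_mul (32 / K ^ 2)) (hiind.const_mul (8 * K ^ 2)),
    integral_const_mul, integral_const_mul,
    integral_inner_stdGaussian z (φ := fun t => t ^ 4) (by fun_prop),
    integral_inner_stdGaussian x hind, hx, hz]
  simp only [one_mul]
  rw [integral_indicator measurableSet_Icc, setIntegral_const, smul_eq_mul, mul_one]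
  have h5 := mul_le_mul_of_nonneg_left (gaussianReal_Icc_le (r := 2 * τ) (by positivity))
    (by positivity : 0 ≤ 8 * K ^ 2)
  linarith

/-! ### Two-sided bounds for all pairs -/

section
variable {E : Type*} [NormedAddCommGroup E] [InnerProductSpace ℝ E] {m : ℕ} {a : Fin m → E}

/-- Close pairs: the empirical ReLU average is controlled by those of the gate and its error. -/
theorem quadAvg_reluDiff_bounds_of_near {τ K κ : ℝ} (hτ : 0 < τ) (hK : 0 < K)
    (hκ : 0 < κ) {x y z : E} {t : ℝ} (ht : 0 < t) (htK : t * K ≤ τ) (hy : y = x - t • z) :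
    quadAvg reluDiff a x y ≤ t ^ 2 * ((1 + κ) * quadAvg (gate τ K) a x z +
        (1 + 1 / κ) * quadAvg (gateError τ K) a x z) ∧
      t ^ 2 * quadAvg (gate τ K) a x z ≤ (1 + κ) * quadAvg reluDiff a x y +
        (1 + 1 / κ) * (t ^ 2 * quadAvg (gateError τ K) a x z) := by
  have hyoung : ∀ {r h e : ℝ}, |(|r| - t * |h|)| ≤ t * e →
      r ^ 2 ≤ t ^ 2 * ((1 + κ) * h ^ 2 + (1 + 1 / κ) * e ^ 2) ∧
      t ^ 2 * h ^ 2 ≤ (1 + κ) * r ^ 2 + (1 + 1 / κ) * (t ^ 2 * e ^ 2) := by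
    intro r h e hr
    have h1 := pow_le_pow_left₀ (abs_nonneg _) hr 2
    rw [sq_abs] at h1
    -- Young's inequality with weight `κ`: the main term loses only the factor `1 + κ`.
    have h2 : ∀ u v : ℝ, u ^ 2 ≤ (1 + κ) * v ^ 2 + (1 + 1 / κ) * (u - v) ^ 2 := fun u v => by
      have : (1 + κ) * v ^ 2 + (1 + 1 / κ) * (u - v) ^ 2 - u ^ 2 =
          (κ * v - (u - v)) ^ 2 / κ := by field_simp; ring
      have : 0 ≤ (κ * v - (u - v)) ^ 2 / κ := by positivity
      linarith
    have h3 := h2 |r| (t * |h|)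
    have h4 := h2 (t * |h|) |r|
    have h5 := mul_le_mul_of_nonneg_left h1 (by positivity : 0 ≤ 1 + 1 / κ)
    have h6 : (t * |h| - |r|) ^ 2 = (|r| - t * |h|) ^ 2 := by ring
    rw [h6] at h4
    rw [mul_pow, sq_abs, sq_abs] at h3 h4
    rw [mul_pow] at h5
    constructor <;> nlinarith
  have hpt := fun i => hyoung (abs_abs_reluDiff_sub_gate_le hτ hK ht htK
    (inner ℝ (a i) x) (inner ℝ (a i) z))
  have hiy : ∀ i, inner ℝ (a i) y = inner ℝ (a i) x - t * inner ℝ (a i) z := fun i => by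
    rw [hy, inner_sub_right, inner_smul_right]
  simp only [← hiy] at hpt
  have hm : (0 : ℝ) ≤ m := Nat.cast_nonneg m
  unfold quadAvg
  have e1 := div_le_div_of_nonneg_right (Finset.sum_le_sum fun i (_ : i ∈ Finset.univ) =>
    (hpt i).1) hm
  have e2 := div_le_div_of_nonneg_right (Finset.sum_le_sum fun i (_ : i ∈ Finset.univ) =>
    (hpt i).2) hm
  simp only [← Finset.mul_sum, Finset.sum_add_distrib] at e1 e2
  constructor
  · refine e1.trans_eq ?_
    ring
  · refine le_trans (le_of_eq ?_) (e2.trans_eq ?_) <;> ring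

theorem quadAvg_reluDiff_comm (x y : E) : quadAvg reluDiff a x y = quadAvg reluDiff a y x := by
  unfold quadAvg reluDiff
  congr 1
  exact Finset.sum_congr rfl fun i _ => by ring

theorem quadAvg_reluDiff_smul {s : ℝ} (hs : 0 ≤ s) (x y : E) :
    quadAvg reluDiff a (s • x) (s • y) = s ^ 2 * quadAvg reluDiff a x y := by
  have h : ∀ p, max 0 (s * p) = s * max 0 p := fun p => by
    rw [mul_max_of_nonneg _ _ hs, mul_zero]
  unfold quadAvg reluDiff
  simp only [inner_smul_right, h]
  rw [← mul_div_assoc, Finset.mul_sum]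
  congr 1
  exact Finset.sum_congr rfl fun i _ => by ring

/-- By homogeneity and symmetry it is enough to bound the increments between a unit vector and a
vector of the unit ball. -/
theorem quadAvg_reluDiff_bounds_of_unit {l u : ℝ}
    (h : ∀ x y : E, ‖x‖ = 1 → ‖y‖ ≤ 1 → x ≠ y →
      l * ‖x - y‖ ^ 2 ≤ quadAvg reluDiff a x y ∧ quadAvg reluDiff a x y ≤ u * ‖x - y‖ ^ 2)
    (x y : E) :
    l * ‖x - y‖ ^ 2 ≤ quadAvg reluDiff a x y ∧ quadAvg reluDiff a x y ≤ u * ‖x - y‖ ^ 2 := by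
  wlog hxy : ‖y‖ ≤ ‖x‖ generalizing x y
  · rw [quadAvg_reluDiff_comm, norm_sub_rev]
    exact this y x (le_of_not_ge hxy)
  rcases eq_or_ne x y with rfl | hne
  · simp [quadAvg, reluDiff]
  have hx : 0 < ‖x‖ := by
    rw [norm_pos_iff]
    rintro rfl
    rw [norm_zero, norm_le_zero_iff] at hxy
    exact hne hxy.symm
  have hs : 0 < ‖x‖⁻¹ := inv_pos.2 hx
  have key := h (‖x‖⁻¹ • x) (‖x‖⁻¹ • y)
    (by rw [norm_smul, norm_inv, norm_norm, inv_mul_cancel₀ hx.ne'])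
    (by rw [norm_smul, norm_inv, norm_norm, inv_mul_le_iff₀ hx, mul_one]; exact hxy)
    (fun heq => hne (smul_right_injective E hs.ne' heq))
  rw [quadAvg_reluDiff_smul hs.le, ← smul_sub, norm_smul, Real.norm_of_nonneg hs.le, mul_pow,
    mul_left_comm l, mul_left_comm u, mul_le_mul_iff_right₀ (by positivity),
    mul_le_mul_iff_right₀ (by positivity)] at key
  exact key
end

/-- With overwhelming probability the squared normalized ReLU distances lie between
`(1/4 - η) ‖x - y‖²` and `(1/2 + η) ‖x - y‖²`. -/
theorem overwhelming_reluDiff_bounds {η : ℝ} (hη : 0 < η) :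
    Overwhelming fun _ _ a => ∀ x y, (1 / 4 - η) * ‖x - y‖ ^ 2 ≤ quadAvg reluDiff a x y ∧
      quadAvg reluDiff a x y ≤ (1 / 2 + η) * ‖x - y‖ ^ 2 := by
  -- With `κ ≤ 1`, the losses for close pairs add up to at most `7 κ`.
  set κ := min 1 (η / 7) with hκdef
  have hκ : 0 < κ := by positivity
  have hκ1 : κ ≤ 1 := min_le_left _ _
  have hκη : 7 * κ ≤ η := by
    have : κ ≤ η / 7 := min_le_right _ _
    linarith
  -- The error must be of order `κ²`, because Young's inequality multiplies it by `1 + 1 / κ`.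
  obtain ⟨τ, hτ, K, hK, herr⟩ := exists_quadMean_gateError_le (κ := κ ^ 2) (by positivity)
  -- For `t ≥ τ / K` this additive tolerance is at most `η t²`; for smaller `t` the linearization
  -- applies.
  have hfar := overwhelming_quadAvg lipschitzPair_reluDiff (η := η * (τ / K) ^ 2) (by positivity)
  have hgate := overwhelming_quadAvg (lipschitzPair_gate hτ hK) (η := κ ^ 2) (by positivity)
  have hgerr := overwhelming_quadAvg (lipschitzPair_gateError hτ hK) (η := κ ^ 2) (by positivity)
  refine (hfar.and (hgate.and hgerr)).mono fun m n a hn hm ⟨h1, h2, h3⟩ =>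
    quadAvg_reluDiff_bounds_of_unit fun x y hx hy hxy => ?_
  set t := ‖x - y‖ with ht
  have ht0 : 0 < t := norm_pos_iff.2 (sub_ne_zero.2 hxy)
  rcases le_total (τ / K) t with hfar' | hnear
  · have e1 := abs_le.1 (h1 x y hx.le hy)
    have e2 := quadMean_reluDiff_bounds x y
    have e3 : η * (τ / K) ^ 2 ≤ η * t ^ 2 := by gcongr
    rw [← ht] at e2
    constructor <;> linarith [e1.1, e1.2, e2.1, e2.2]
  · set z := t⁻¹ • (x - y) with hz
    have hz1 : ‖z‖ = 1 := by
      rw [hz, norm_smul, norm_inv, ht, norm_norm, inv_mul_cancel₀ (ht ▸ ht0).ne']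
    have hyz : y = x - t • z := by
      rw [hz, smul_smul, mul_inv_cancel₀ ht0.ne', one_smul, sub_sub_cancel]
    have hb := quadAvg_reluDiff_bounds_of_near (a := a) hτ hK hκ ht0 ((le_div_iff₀ hK).1 hnear) hyz
    have eg := abs_le.1 (h2 x z hx.le hz1.le)
    have ee := abs_le.1 (h3 x z hx.le hz1.le)
    have mg := quadMean_gate_bounds hτ hK x z
    rw [hz1] at mg
    have me := herr n x z hx hz1
    have g1 : quadAvg (gate τ K) a x z ≤ 1 / 2 + κ ^ 2 := by linarith [eg.2, mg.2]
    have g2 : 1 / 2 - 2 * κ ^ 2 ≤ quadAvg (gate τ K) a x z := by nlinarith [eg.1, mg.1]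
    have g3 : quadAvg (gateError τ K) a x z ≤ 2 * κ ^ 2 := by linarith [ee.2]
    have g4 : (1 + 1 / κ) * quadAvg (gateError τ K) a x z ≤ 4 * κ := by
      calc _ ≤ (1 + 1 / κ) * (2 * κ ^ 2) := by gcongr
        _ = 2 * κ ^ 2 + 2 * κ := by field_simp
        _ ≤ _ := by nlinarith
    have ht2 : 0 < t ^ 2 := by positivity
    constructor
    · have q1 : t ^ 2 * (1 / 2 - 2 * κ ^ 2 - 4 * κ) ≤ (1 + κ) * quadAvg reluDiff a x y := by
        have := mul_le_mul_of_nonneg_left g4 ht2.le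
        have := mul_le_mul_of_nonneg_left g2 ht2.le
        linarith [hb.2]
      have q2 : (1 + κ) * ((1 / 4 - η) * t ^ 2) ≤ t ^ 2 * (1 / 2 - 2 * κ ^ 2 - 4 * κ) := by
        have : (1 + κ) * (1 / 4 - η) ≤ 1 / 2 - 2 * κ ^ 2 - 4 * κ := by nlinarith
        nlinarith
      exact le_of_mul_le_mul_left (q2.trans q1) (by positivity)
    · refine hb.1.trans ?_
      rw [mul_comm]
      refine mul_le_mul_of_nonneg_right ?_ ht2.le
      have : (1 + κ) * quadAvg (gate τ K) a x z ≤ (1 + κ) * (1 / 2 + κ ^ 2) := by gcongr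
      nlinarith [mul_pos hκ hκ]

/-! ### From quadratic bounds to the condition number -/

section
variable {m n : ℕ} (A : Matrix (Fin m) (Fin n) ℝ)

theorem norm_reluLayer_sub_sq (x y : EuclideanSpace ℝ (Fin n)) :
    ‖reluLayer A 0 x - reluLayer A 0 y‖ ^ 2 =
      ∑ i, reluDiff (inner ℝ (WithLp.toLp 2 (A i)) x) (inner ℝ (WithLp.toLp 2 (A i)) y) ^ 2 := by
  have h : ∀ (i : Fin m) (x : EuclideanSpace ℝ (Fin n)),
      (A *ᵥ x.ofLp) i = inner ℝ (WithLp.toLp 2 (A i)) x := fun i x => by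
    simp [Matrix.mulVec, dotProduct, PiLp.inner_apply, mul_comm]
  rw [EuclideanSpace.real_norm_sq_eq]
  simp only [reluLayer, PiLp.sub_apply, h, Pi.zero_apply, add_zero, reluDiff]

theorem reluRatio_nonneg (b : Fin m → ℝ) (x y : EuclideanSpace ℝ (Fin n)) :
    0 ≤ reluRatio A b x y := by
  unfold reluRatio; positivity

theorem reluRatio_sq (x y : EuclideanSpace ℝ (Fin n)) :
    reluRatio A 0 x y ^ 2 = quadAvg reluDiff (fun i => WithLp.toLp 2 (A i)) x y / ‖x - y‖ ^ 2 := by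
  rw [reluRatio, mul_pow, div_pow, div_pow, norm_reluLayer_sub_sq, Real.sq_sqrt (Nat.cast_nonneg m),
    quadAvg]
  ring

theorem conditionNumber_le_of_bounds {l u β : ℝ} (hl : 0 < l) (hβ : 0 ≤ β) (hlu : u ≤ β ^ 2 * l)
    (h : ∀ x y : EuclideanSpace ℝ (Fin n),
      l * ‖x - y‖ ^ 2 ≤ quadAvg reluDiff (fun i => WithLp.toLp 2 (A i)) x y ∧
      quadAvg reluDiff (fun i => WithLp.toLp 2 (A i)) x y ≤ u * ‖x - y‖ ^ 2) :
    conditionNumber A 0 ≤ ENNReal.ofReal β := by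
  have hL : ENNReal.ofReal √l ≤ lowerLip A 0 := by
    refine le_iInf fun x => le_iInf fun y => le_iInf fun hxy => ENNReal.ofReal_le_ofReal ?_
    have hpos : 0 < ‖x - y‖ := norm_pos_iff.2 (sub_ne_zero.2 hxy)
    refine Real.sqrt_le_iff.2 ⟨reluRatio_nonneg _ _ _ _, ?_⟩
    rw [reluRatio_sq, le_div_iff₀ (by positivity)]
    exact (h x y).1
  have hU : upperLip A 0 ≤ ENNReal.ofReal (β * √l) := by
    refine iSup_le fun x => iSup_le fun y => iSup_le fun hxy => ENNReal.ofReal_le_ofReal ?_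
    have hpos : 0 < ‖x - y‖ := norm_pos_iff.2 (sub_ne_zero.2 hxy)
    refine (pow_le_pow_iff_left₀ (reluRatio_nonneg _ _ _ _) (by positivity) two_ne_zero).1 ?_
    rw [reluRatio_sq, mul_pow, Real.sq_sqrt hl.le, div_le_iff₀ (by positivity)]
    exact (h x y).2.trans (by gcongr)
  have hL0 : lowerLip A 0 ≠ 0 := by
    have : 0 < ENNReal.ofReal √l := ENNReal.ofReal_pos.2 (Real.sqrt_pos.2 hl)
    exact (this.trans_le hL).ne'
  rw [conditionNumber, if_neg hL0]
  refine ENNReal.div_le_of_le_mul (hU.trans ?_)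
  rw [ENNReal.ofReal_mul hβ]
  gcongr

/-- The condition number of a ReLU layer without bias is at least `√2`. -/
theorem sqrt_two_le_conditionNumber (hn : 0 < n) :
    ENNReal.ofReal √2 ≤ conditionNumber A 0 := by
  rw [conditionNumber]
  split_ifs with hL0
  · exact le_top
  have : Nonempty (Fin n) := ⟨⟨0, hn⟩⟩
  obtain ⟨x, hx⟩ := exists_ne (0 : EuclideanSpace ℝ (Fin n))
  have hxneg : x ≠ -x := fun h => by
    rw [eq_neg_iff_add_eq_zero, ← two_smul ℝ x, smul_eq_zero] at h
    exact hx (h.resolve_left two_ne_zero)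
  have hL : lowerLip A 0 ≤ ENNReal.ofReal (reluRatio A 0 x (-x)) :=
    (iInf_le _ x).trans ((iInf_le _ (-x)).trans (iInf_le _ hxneg))
  have hU : ∀ y : EuclideanSpace ℝ (Fin n), y ≠ 0 →
      ENNReal.ofReal (reluRatio A 0 y 0) ≤ upperLip A 0 := fun y hy =>
    le_iSup_of_le y (le_iSup_of_le 0 (le_iSup_of_le hy le_rfl))
  -- Each neuron is active at no more than one of `x` and `-x`, so squared increments from 0 add up;
  -- the 4 is `‖x - (-x)‖² / ‖x‖²`.
  have hsum : reluRatio A 0 x 0 ^ 2 + reluRatio A 0 (-x) 0 ^ 2 =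
      4 * reluRatio A 0 x (-x) ^ 2 := by
    have hnorm : ‖x - -x‖ ^ 2 = 4 * ‖x‖ ^ 2 := by
      rw [sub_neg_eq_add, ← two_smul ℝ x, norm_smul, mul_pow]; norm_num
    have hx' : ‖x‖ ≠ 0 := norm_ne_zero_iff.2 hx
    have hpt : ∀ p : ℝ, reluDiff p 0 ^ 2 + reluDiff (-p) 0 ^ 2 = reluDiff p (-p) ^ 2 := fun p => by
      unfold reluDiff
      rcases le_total 0 p with hp | hp
      · rw [max_eq_right hp, max_self, max_eq_left (by linarith : -p ≤ 0)]; ring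
      · rw [max_eq_left hp, max_self, max_eq_right (by linarith : 0 ≤ -p)]; ring
    rw [reluRatio_sq, reluRatio_sq, reluRatio_sq, hnorm, sub_zero, sub_zero, norm_neg, quadAvg,
      quadAvg, quadAvg]
    simp only [inner_neg_right, inner_zero_right, ← hpt, Finset.sum_add_distrib]
    field_simp
  have hmain : ENNReal.ofReal (√2 * reluRatio A 0 x (-x)) ≤ upperLip A 0 := by
    have hsq : (√2 * reluRatio A 0 x (-x)) ^ 2 = 2 * reluRatio A 0 x (-x) ^ 2 := by
      rw [mul_pow, Real.sq_sqrt (by norm_num)]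
    -- The larger of the two squared ratios is at least their mean, `2 * reluRatio A 0 x (-x) ^ 2`.
    rcases le_total (reluRatio A 0 x 0 ^ 2) (reluRatio A 0 (-x) 0 ^ 2) with h | h
    · refine le_trans (ENNReal.ofReal_le_ofReal ?_) (hU (-x) (neg_ne_zero.2 hx))
      exact (pow_le_pow_iff_left₀ (mul_nonneg (Real.sqrt_nonneg 2) (reluRatio_nonneg _ _ _ _))
        (reluRatio_nonneg _ _ _ _) two_ne_zero).1 (by linarith)
    · refine le_trans (ENNReal.ofReal_le_ofReal ?_) (hU x hx)
      exact (pow_le_pow_iff_left₀ (mul_nonneg (Real.sqrt_nonneg 2) (reluRatio_nonneg _ _ _ _))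
        (reluRatio_nonneg _ _ _ _) two_ne_zero).1 (by linarith)
  rw [ENNReal.le_div_iff_mul_le (Or.inl hL0)
    (Or.inl (ne_top_of_le_ne_top ENNReal.ofReal_ne_top hL))]
  refine le_trans ?_ hmain
  rw [ENNReal.ofReal_mul (Real.sqrt_nonneg 2)]
  gcongr
end

/-! ### The high-probability bound and the limit -/

theorem overwhelming_conditionNumber_le {δ : ℝ} (hδ0 : 0 < δ) (hδ : δ < 4 / 5) :
    Overwhelming fun m n a => conditionNumber (fun (i : Fin m) (j : Fin n) => a i j) 0 ≤
      ENNReal.ofReal (√2 + δ) := by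
  -- Since `(√2 + δ)² ≥ 2 + 2δ`, it is enough that `(2 + 2δ)(1/4 - δ/10) ≥ 1/2 + δ/10`, which
  -- amounts to `δ² ≤ δ`.
  refine (overwhelming_reluDiff_bounds (η := δ / 10) (by positivity)).mono fun m n a _ _ h => ?_
  refine conditionNumber_le_of_bounds (l := 1 / 4 - δ / 10) (u := 1 / 2 + δ / 10) _
    (by linarith) (by positivity) ?_ h
  have h1 : 1 ≤ √2 := Real.one_le_sqrt.2 (by norm_num)
  have h2 : √2 ^ 2 = 2 := Real.sq_sqrt (by norm_num)
  have h3 : 2 + 2 * δ ≤ (√2 + δ) ^ 2 := by nlinarith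
  nlinarith

theorem exists_conditionNumber_le {δ : ℝ} (hδ0 : 0 < δ) (hδ : δ < 4 / 5) :
    ∃ c : ℝ, 0 < c ∧ ∃ C : ℝ, 0 < C ∧ ∀ m n : ℕ, 0 < n → C * (n : ℝ) ≤ (m : ℝ) →
      ∀ (Ω : Type*) [MeasurableSpace Ω] (P : Measure Ω) [IsProbabilityMeasure P]
        (A : Ω → Matrix (Fin m) (Fin n) ℝ), IsStandardGaussianMatrix A P →
        1 - 2 * Real.exp (-c * (m : ℝ)) ≤
          P.real {ω | conditionNumber (A ω) 0 ≤ ENNReal.ofReal (√2 + δ)} :=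
  (overwhelming_conditionNumber_le hδ0 hδ).exists_isStandardGaussianMatrix

theorem tendsto_conditionNumber {m n : ℕ → ℕ} (hn : ∀ k, 0 < n k)
    (hmn : Tendsto (fun k => (m k : ℝ) / (n k : ℝ)) atTop atTop)
    {Ω : ℕ → Type*} [∀ k, MeasurableSpace (Ω k)] {P : ∀ k, Measure (Ω k)}
    [∀ k, IsProbabilityMeasure (P k)] {A : ∀ k, Ω k → Matrix (Fin (m k)) (Fin (n k)) ℝ}
    (hA : ∀ k, IsStandardGaussianMatrix (A k) (P k)) {ε : ℝ} (hε : 0 < ε) :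
    Tendsto (fun k => (P k).real {ω | ENNReal.ofReal √2 ≤ conditionNumber (A k ω) 0 ∧
      conditionNumber (A k ω) 0 ≤ ENNReal.ofReal (√2 + ε)}) atTop (𝓝 1) := by
  obtain ⟨c, hc, C, hC, h⟩ := exists_conditionNumber_le (δ := min ε (1 / 2)) (by positivity)
    ((min_le_right _ _).trans_lt (by norm_num))
  have hm : Tendsto (fun k => (m k : ℝ)) atTop atTop := by
    refine tendsto_atTop_mono (fun k => ?_) hmn
    exact div_le_self (Nat.cast_nonneg _) (by exact_mod_cast hn k)
  have hlim : Tendsto (fun k => 1 - 2 * Real.exp (-c * (m k : ℝ))) atTop (𝓝 1) := by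
    have h1 : Tendsto (fun k => Real.exp (-c * (m k : ℝ))) atTop (𝓝 0) :=
      Real.tendsto_exp_atBot.comp (hm.const_mul_atTop_of_neg (by linarith))
    simpa using (h1.const_mul 2).const_sub 1
  refine tendsto_of_tendsto_of_tendsto_of_le_of_le' hlim tendsto_const_nhds ?_
    (Eventually.of_forall fun k => measureReal_le_one)
  filter_upwards [hmn.eventually_ge_atTop C] with k hk
  have hn' : (0 : ℝ) < n k := by exact_mod_cast hn k
  refine (h (m k) (n k) (hn k) ((le_div_iff₀ hn').1 hk) (Ω k) (P k) (A k) (hA k)).trans ?_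
  -- The lower bound `√2` holds for every matrix, so it costs no probability.
  refine measureReal_mono fun ω hω => ⟨sqrt_two_le_conditionNumber _ (hn k), hω.trans ?_⟩
  exact ENNReal.ofReal_le_ofReal (by gcongr; exact min_le_left _ _)

/-- The first part is the bound with exponentially high probability. The second part says that
the value `√2` is attained asymptotically: for standard Gaussian matrices of sizes `m k × n k`
with `m k / n k → ∞` (in particular, for `n` fixed and `m → ∞`), the condition number with zero
bias lies in `[√2, √2 + ε]` with probability tending to one, for every `ε > 0`. -/
theorem theorem2 :
    (∀ δ : ℝ, 0 < δ → δ < 4 / 5 →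
      ∃ c : ℝ, 0 < c ∧ ∃ C : ℝ, 0 < C ∧
        ∀ m n : ℕ, 0 < n → C * (n : ℝ) ≤ (m : ℝ) →
          ∀ (Ω : Type*) [MeasurableSpace Ω] (P : Measure Ω) [IsProbabilityMeasure P]
            (A : Ω → Matrix (Fin m) (Fin n) ℝ), IsStandardGaussianMatrix A P →
            1 - 2 * Real.exp (-c * (m : ℝ)) ≤
              P.real {ω | conditionNumber (A ω) 0 ≤ ENNReal.ofReal (√2 + δ)}) ∧
    (∀ m n : ℕ → ℕ, (∀ k, 0 < n k) →
      Tendsto (fun k => (m k : ℝ) / (n k : ℝ)) atTop atTop →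
        ∀ (Ω : ℕ → Type*) [∀ k, MeasurableSpace (Ω k)] (P : ∀ k, Measure (Ω k))
          [∀ k, IsProbabilityMeasure (P k)]
          (A : ∀ k, Ω k → Matrix (Fin (m k)) (Fin (n k)) ℝ),
          (∀ k, IsStandardGaussianMatrix (A k) (P k)) →
          ∀ ε : ℝ, 0 < ε →
            Tendsto
              (fun k => (P k).real {ω | ENNReal.ofReal √2 ≤ conditionNumber (A k ω) 0 ∧
                conditionNumber (A k ω) 0 ≤ ENNReal.ofReal (√2 + ε)})
              atTop (𝓝 1)) :=
  ⟨fun _ hδ0 hδ => exists_conditionNumber_le hδ0 hδ,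
    fun _ _ hn hmn _ _ _ _ _ hA _ hε => tendsto_conditionNumber hn hmn hA hε⟩
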